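/- **Setting.** For $n\ge 1$ let $x_i=i/n$ ($1\le i\le n$) and let $Y_i=f_0(x_i)+\varepsilon_i$ with $\varepsilon_1,\dots,\varepsilon_n$ i.i.d. $\mathcal N(0,1)$; write $P_0^n$ for the law of $Y^{(n)}=(Y_1,\dots,Y_n)$. Let $f_0:[0,1]\to\mathbb R$ be $\alpha$-Hölder continuous and $a:[0,1]\to\mathbb R$ be $\gamma$-Hölder continuous, with $1/2<\alpha\le 1$ and $\gamma>1/2$. Put $\Psi(f)=\frac1n\sum_{i=1}^n a(x_i)f(x_i)$, $\|a\|_L^2=\frac1n\sum_{i=1}^n a(x_i)^2$ and $W_n(g)=\frac1n\sum_{i=1}^n\sqrt n\,\varepsilon_i\,g(x_i)$. Let $K=K_n=\lfloor (n/\log n)^{1/(2\alpha+1)}\rfloor$ and, for each $n$, let $\Omega_1,\dots,\Omega_K$ be a fixed equivalent-blocks partition of $[0,1]$: disjoint intervals with union $[0,1]$ such that $\mu(\Omega_k)=\frac1n\#\{i:x_i\in\Omega_k\}$ satisfies $c_1/K_n\le\mu(\Omega_k)\le c_2/K_n$ for all $k$ and all large $n$, with constants $0<c_1\le c_2$ not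 depending on $k$ and $n$. For $\beta\in\mathbb R^K$ let $f^K=f^K_\beta=\sum_{k=1}^K\beta_k\mathbf 1_{\Omega_k}$. For a function $g$ on $[0,1]$ let $g^K=\sum_k g^K_k\mathbf 1_{\Omega_k}$, where $g^K_k$ is the average of $g$ over the design points in $\Omega_k$, and set $$\widehat\Psi_K=\Psi(f_0^K)+\frac{W_n(a^K)}{\sqrt n},\qquad \Psi_n=\Psi(f_0)+\frac{W_n(a)}{\sqrt n}.$$ A prior on $\beta$ and the Gaussian likelihood $\prod_{i=1}^n(2\pi)^{-1/2}\exp\{-(Y_i-f^K_\beta(x_i))^2/2\}$ give, by Bayes' formula, a posterior $\Pi(\cdot\mid Y^{(n)})$. **Theorem 1.** Assume that the prior on $\beta\in\mathbb R^{K_n}$ is one of the following: (i) $\mathcal N_{K_n}(0,\Sigma_n)$ with positive definite matrices $\Sigma_n$ such that, for some constants $c>0$ and $C$ and all large $n$, $\lambda_{\min}(\Sigma_n)>c$ and $\lambda_{\max}(\Sigma_n)\le Cn$; (ii) the product of $K_n$ Laplace laws with density $\frac{\lambda}{2}e^{-\lambda|b|}$, for a fixed $\lambda>0$. Then the posterior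 distribution of $\sqrt n\,(\Psi(f^K)-\widehat\Psi_K)$ converges weakly to $\mathcal N(0,\|a\|_L^2)$ (variance $\|a\|_L^2$) in $P_0^n$-probability, that is, $$\beta_{BL}\Big(\Pi\big(\sqrt n(\Psi(f^K)-\widehat\Psi_K)\in\cdot\mid Y^{(n)}\big),\ \mathcal N(0,\|a\|_L^2)\Big)\longrightarrow 0\quad\text{in }P_0^n\text{-probability as }n\to\infty,$$ where $\beta_{BL}(P,Q)=\sup\{|\int g\,dP-\int g\,dQ|:\ \|g\|_\infty+\|g\|_{\mathrm{Lip}}\le 1\}$ is the bounded Lipschitz metric. Moreover $\sqrt n\,(\widehat\Psi_K-\Psi_n)\to0$ in $P_0^n$-probability. -/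

import Mathlib

open MeasureTheory ProbabilityTheory Filter Topology
open scoped NNReal ENNReal

noncomputable section

namespace HistogramBvM

/-! ### Regression with the regular design `x_i = i / n` -/

/-- The design point `x_i = i / n`, `1 ≤ i ≤ n`; the index `i : Fin n` starts at `0`. -/
def design (n : ℕ) (i : Fin n) : ℝ := ((i : ℕ) + 1 : ℝ) / (n : ℝ)

/-- The law `P_0^n` of `Y_i = f₀(x_i) + ε_i`, `1 ≤ i ≤ n`, with `ε_i` i.i.d. `N(0,1)`. -/
def truth (n : ℕ) (f₀ : ℝ → ℝ) : Measure (Fin n → ℝ) :=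
  Measure.pi fun i => gaussianReal (f₀ (design n i)) 1

/-- The log-likelihood of the regression function `f` given the responses `Y`. -/
def logLik (n : ℕ) (Y : Fin n → ℝ) (f : ℝ → ℝ) : ℝ :=
  -((n : ℝ) / 2) * Real.log (2 * Real.pi) - ∑ i, (Y i - f (design n i)) ^ 2 / 2

/-- The empirical inner product `⟨f, g⟩_L = (1/n) ∑ f(x_i) g(x_i)`. -/
def innerL (n : ℕ) (f g : ℝ → ℝ) : ℝ :=
  (1 / (n : ℝ)) * ∑ i, f (design n i) * g (design n i)

/-- The squared empirical norm `‖f‖_L² = (1/n) ∑ f(x_i)²`. -/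
def normSqL (n : ℕ) (f : ℝ → ℝ) : ℝ :=
  (1 / (n : ℝ)) * ∑ i, f (design n i) ^ 2

/-- The linear functional `Ψ(f) = (1/n) ∑ a(x_i) f(x_i)`. -/
def psi (n : ℕ) (a f : ℝ → ℝ) : ℝ := innerL n a f

/-- `W_n(g) = (1/n) ∑ √n ε_i g(x_i)`, with the noise `ε_i = Y_i - f₀(x_i)`. -/
def W (n : ℕ) (f₀ : ℝ → ℝ) (Y : Fin n → ℝ) (g : ℝ → ℝ) : ℝ :=
  (1 / (n : ℝ)) * ∑ i, Real.sqrt n * (Y i - f₀ (design n i)) * g (design n i)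

/-! ### Partitions, step functions and projections -/

/-- The number of cells `K_n = ⌊(n / log n)^{1/(2α+1)}⌋`. -/
def Kn (α : ℝ) (n : ℕ) : ℕ := ⌊((n : ℝ) / Real.log n) ^ (1 / (2 * α + 1))⌋₊

/-- `μ(Ω) = (1/n) ∑ 1(x_i ∈ Ω)`, the proportion of design points in `Ω`. -/
def cellMass (n : ℕ) (Ω : Set ℝ) : ℝ :=
  (1 / (n : ℝ)) * ∑ i, Ω.indicator (fun _ => (1 : ℝ)) (design n i)

/-- The sets `Ω_1, …, Ω_K` are intervals that partition `[0,1]`. -/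
structure IsIntervalPartition {K : ℕ} (Ω : Fin K → Set ℝ) : Prop where
  interval : ∀ k, (Ω k).OrdConnected
  disjoint : Pairwise fun j k => Disjoint (Ω j) (Ω k)
  cover : ⋃ k, Ω k = Set.Icc 0 1

/-- A sequence of equivalent blocks partitions of `[0,1]` into `K n` intervals:
`μ(Ω_k) ≍ 1 / K n`, uniformly in `k` and in (large) `n`. -/
def EquivalentBlocks (K : ℕ → ℕ) (Ω : ∀ n, Fin (K n) → Set ℝ) : Prop :=
  ∃ c C : ℝ, 0 < c ∧ 0 < C ∧ ∀ᶠ n in atTop, IsIntervalPartition (Ω n) ∧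
    ∀ k, c / (K n : ℝ) ≤ cellMass n (Ω n k) ∧ cellMass n (Ω n k) ≤ C / (K n : ℝ)

/-- The step function `f^K_β = ∑ 1(x ∈ Ω_k) β_k`. -/
def stepFun {K : ℕ} (Ω : Fin K → Set ℝ) (β : Fin K → ℝ) (x : ℝ) : ℝ :=
  ∑ k, (Ω k).indicator (fun _ => β k) x

/-- The step heights of the projection of `g` onto the step functions: the averages of `g` over
the design points in each cell. -/
def projCoef (n : ℕ) {K : ℕ} (Ω : Fin K → Set ℝ) (g : ℝ → ℝ) (k : Fin K) : ℝ :=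
  ∑ i, (Ω k).indicator (fun _ => (1 : ℝ)) (design n i) / (n : ℝ) *
    (g (design n i) / cellMass n (Ω k))

/-- The projection `g^K` of `g` onto the step functions on the partition. -/
def proj (n : ℕ) {K : ℕ} (Ω : Fin K → Set ℝ) (g : ℝ → ℝ) : ℝ → ℝ :=
  stepFun Ω (projCoef n Ω g)

/-- The centering `Ψ̂_K = Ψ(f₀^K) + W_n(a^K) / √n`. -/
def psiHat (n : ℕ) {K : ℕ} (Ω : Fin K → Set ℝ) (f₀ a : ℝ → ℝ) (Y : Fin n → ℝ) : ℝ :=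
  psi n a (proj n Ω f₀) + W n f₀ Y (proj n Ω a) / Real.sqrt n

/-- The centering `Ψ_n = Ψ(f₀) + W_n(a) / √n`. -/
def psiN (n : ℕ) (f₀ a : ℝ → ℝ) (Y : Fin n → ℝ) : ℝ :=
  psi n a f₀ + W n f₀ Y a / Real.sqrt n

/-! ### Priors on the step heights -/

/-- The Gaussian prior `N_K(0, S)` on the vector of step heights. -/
def gaussianPrior {K : ℕ} (S : Matrix (Fin K) (Fin K) ℝ) : Measure (Fin K → ℝ) :=
  (multivariateGaussian (0 : EuclideanSpace ℝ (Fin K)) S).map WithLp.ofLp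

/-- Covariance matrices `S n` (positive definite) with `λ_min(S n) > c > 0` and
`λ_max(S n) ≲ n`. -/
def AdmissibleCov (K : ℕ → ℕ) (S : ∀ n, Matrix (Fin (K n)) (Fin (K n)) ℝ) : Prop :=
  ∃ c C : ℝ, 0 < c ∧ ∀ᶠ n : ℕ in atTop, ∃ h : (S n).PosDef,
    ∀ k, c < h.isHermitian.eigenvalues k ∧ h.isHermitian.eigenvalues k ≤ C * (n : ℝ)

/-- The Laplace law on `ℝ` with density `(l / 2) exp (-l |b|)`. -/
def laplaceReal (l : ℝ) : Measure ℝ :=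
  volume.withDensity fun b => ENNReal.ofReal (l / 2 * Real.exp (-l * |b|))

/-- The independent product of Laplace laws on the step heights. -/
def laplacePrior (l : ℝ) (K : ℕ) : Measure (Fin K → ℝ) :=
  Measure.pi fun _ => laplaceReal l

/-! ### Posterior distributions and convergence -/

/-- The posterior of the step heights: `exp (ℓ_n(f^K_β)) dΠ(β) / ∫ exp (ℓ_n(f^K_β)) dΠ(β)`. -/
def stepPosterior (n : ℕ) {K : ℕ} (Ω : Fin K → Set ℝ) (prior : Measure (Fin K → ℝ))
    (Y : Fin n → ℝ) : Measure (Fin K → ℝ) :=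
  prior.tilted fun β => logLik n Y (stepFun Ω β)

/-- The posterior distribution of `√n (Ψ(f^K) - Ψ̂_K)`. -/
def posteriorPsi (n : ℕ) {K : ℕ} (Ω : Fin K → Set ℝ) (f₀ a : ℝ → ℝ)
    (prior : Measure (Fin K → ℝ)) (Y : Fin n → ℝ) : Measure ℝ :=
  (stepPosterior n Ω prior Y).map fun β =>
    Real.sqrt n * (psi n a (stepFun Ω β) - psiHat n Ω f₀ a Y)

/-- Functions `g` on `ℝ` with `‖g‖_∞ + ‖g‖_Lip ≤ 1`. -/
def InBLUnitBall (g : ℝ → ℝ) : Prop :=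
  ∃ M L : ℝ≥0, (∀ x, |g x| ≤ M) ∧ LipschitzWith L g ∧ M + L ≤ 1

/-- The bounded Lipschitz metric between (probability) measures on `ℝ`. -/
def blDist (μ ν : Measure ℝ) : ℝ :=
  sSup {r | ∃ g, InBLUnitBall g ∧ r = |∫ x, g x ∂μ - ∫ x, g x ∂ν|}

/-- `Z n → 0` in `P_0^n`-probability. -/
def TendstoZeroInProb (f₀ : ℝ → ℝ) (Z : ∀ n, (Fin n → ℝ) → ℝ) : Prop :=
  ∀ δ : ℝ, 0 < δ → Tendsto (fun n => truth n f₀ {Y | δ ≤ |Z n Y|}) atTop (𝓝 0)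

/-- The posterior of `√n (Ψ(f^K) - Ψ̂_K)` converges weakly to `N(0, ‖a‖_L²)` in
`P_0^n`-probability: the bounded Lipschitz distance tends to zero in probability. -/
def PosteriorAsympNormal (K : ℕ → ℕ) (Ω : ∀ n, Fin (K n) → Set ℝ) (f₀ a : ℝ → ℝ)
    (prior : ∀ n, Measure (Fin (K n) → ℝ)) : Prop :=
  TendstoZeroInProb f₀ fun n Y =>
    blDist (posteriorPsi n (Ω n) f₀ a (prior n) Y) (gaussianReal 0 (normSqL n a).toNNReal)

end HistogramBvM

end

/-! Write `v = a^K / √n`. Cell averaging is an orthogonal projection, so `T = √n (Ψ(f^K) - Ψ̂_K)` is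
the pairing of `v` with the residuals `β - Y`. The Gaussian likelihood is quadratic in `β`: along `β
↦ β + h v` the negative log-likelihood changes by exactly `h T + h² τ / 2`, with `τ` the sum of `v²`
over the design points, while `T` moves by `h τ`. With a shift-invariant prior this would make `T`
exactly `N(0, τ)`. The core estimate, `norm_charFun_map_tilted_sub_le`, says that a defect of at
most `ε |h|` in the change of potential changes the characteristic function by at most `ε |s|`. No
posterior contraction or Laplace expansion is needed.

For the Laplace prior the defect is `l ∑ |v_k|`, of order `K / √n`, which vanishes since `α > 1/2`.
For the Gaussian prior a corrected shift solves a linear system and leaves no defect; the price is a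
mean `m` and a changed variance `τ`, both controlled by `λ_min > c`
(`charFun_posteriorPsi_gaussianPrior`).

It remains to pass from characteristic functions to the bounded Lipschitz metric, uniformly over
bounded variances (`exists_forall_blDist_gaussianReal_le`), and to compare `τ` with `‖a‖_L²`, where
the gap is a squared projection residual of `a`. The two centerings differ by a product of the
residuals of `a` and `f₀`, of order `√n K^{-(α+γ)}`, plus noise of vanishing variance. -/

noncomputable section

namespace HistogramBvM

/-! ### Gaussian approximation from approximate shift equations -/

section ApproxShift

variable {E : Type*} [AddCommGroup E] [Module ℝ E] [MeasurableSpace E] [MeasurableAdd E]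
  {μ : Measure E} [μ.IsAddRightInvariant] [NeZero μ] {U T : E → ℝ} {w : E} {τ m ε : ℝ}

-- The shift by `-h • w` bounds `exp (-U + h (T - m))` by a constant times a translate of `exp
-- (-U)`, so invariance of `μ` yields all exponential moments.
omit [NeZero μ] in
lemma integrable_exp_mul_tilted_of_shift (hU : Integrable (fun x => Real.exp (-U x)) μ)
    (hTm : Measurable T)
    (hshift : ∀ (h : ℝ) x, |U (x + h • w) - U x - h * (T x - m) - h ^ 2 * τ / 2| ≤ |h| * ε)
    (h : ℝ) :
    Integrable (fun x => Real.exp (h * (T x - m))) (μ.tilted fun x => -U x) := by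
  rw [integrable_tilted_iff hU]
  have hU' := hU.comp_add_right ((-h) • w)
  have hmeas : AEStronglyMeasurable (fun x => Real.exp (-U x) • Real.exp (h * (T x - m))) μ :=
    hU.1.smul (by fun_prop : Measurable fun x => Real.exp (h * (T x - m))).aestronglyMeasurable
  refine (hU'.const_mul (Real.exp (h ^ 2 * τ / 2 + |h| * ε))).mono' hmeas
    (ae_of_all _ fun x => ?_)
  rw [smul_eq_mul, ← Real.exp_add, ← Real.exp_add, Real.norm_eq_abs, Real.abs_exp,
    Real.exp_le_exp]
  have := (abs_le.1 (hshift (-h) x)).2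
  rw [abs_neg] at this
  nlinarith

/-- Translating the second integral by `h • w` makes the integrands agree up to a factor `exp θ`,
with `θ` the defect in `hshift`. Since the translated density has mass one, the pointwise bound on
`|exp θ - 1|` survives integration. -/
lemma norm_shift_sub_le (hU : Integrable (fun x => Real.exp (-U x)) μ) (hTm : Measurable T)
    (hT : ∀ (h : ℝ) x, T (x + h • w) = T x + h * τ)
    (hshift : ∀ (h : ℝ) x, |U (x + h • w) - U x - h * (T x - m) - h ^ 2 * τ / 2| ≤ |h| * ε)
    (s h : ℝ) :
    ‖Complex.exp (Complex.I * s * h * τ - h ^ 2 * τ / 2) *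
        complexMGF (fun x => T x - m) (μ.tilted fun x => -U x) (s * Complex.I - h) -
      complexMGF (fun x => T x - m) (μ.tilted fun x => -U x) (s * Complex.I)‖ ≤
      Real.exp (|h| * ε) - 1 := by
  have hprob : IsProbabilityMeasure (μ.tilted fun x => -U x) := isProbabilityMeasure_tilted hU
  set Z := ∫ x, Real.exp (-U x) ∂μ with hZ
  have hZ0 : 0 < Z := integral_exp_pos hU
  set X : E → ℝ := fun x => T x - m with hX
  have hXm : Measurable X := by fun_prop
  have hint : ∀ z : ℂ, Integrable (fun x => (Real.exp (-U x) / Z) • Complex.exp (z * X x)) μ := by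
    intro z
    have h1 : Integrable (fun x => Complex.exp (z * X x)) (μ.tilted fun x => -U x) := by
      refine (integrable_exp_mul_tilted_of_shift hU hTm hshift z.re).mono'
        (by fun_prop : Measurable fun x => Complex.exp (z * X x)).aestronglyMeasurable
        (ae_of_all _ fun x => ?_)
      rw [Complex.norm_exp]
      simp [hX]
    have h2 := ((integrable_tilted_iff hU _).1 h1).smul Z⁻¹
    refine h2.congr (ae_of_all _ fun x => ?_)
    simp only [Pi.smul_apply, smul_smul]
    rw [div_eq_inv_mul]
  have hmgf : ∀ z, complexMGF X (μ.tilted fun x => -U x) z =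
      ∫ x, (Real.exp (-U x) / Z) • Complex.exp (z * X x) ∂μ := fun z => by
    rw [complexMGF, integral_tilted]
  rw [hmgf, hmgf, ← integral_const_mul,
    ← integral_add_right_eq_self
      (fun x => (Real.exp (-U x) / Z) • Complex.exp (s * Complex.I * X x)) (h • w),
    ← integral_sub ((hint _).const_mul _) ((hint _).comp_add_right _)]
  have hbound : ∫ x, (Real.exp (|h| * ε) - 1) * (Real.exp (-U (x + h • w)) / Z) ∂μ =
      Real.exp (|h| * ε) - 1 := by
    rw [integral_const_mul, integral_div,
      integral_add_right_eq_self (fun x => Real.exp (-U x)) (h • w), div_self hZ0.ne', mul_one]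
  rw [← hbound]
  refine norm_integral_le_of_norm_le (((hU.comp_add_right _).div_const Z).const_mul _)
    (ae_of_all _ fun x => ?_)
  set θ := U (x + h • w) - U x - h * (T x - m) - h ^ 2 * τ / 2 with hθ
  have hfac : Complex.exp (Complex.I * s * h * τ - h ^ 2 * τ / 2) *
        (Real.exp (-U x) / Z) • Complex.exp ((s * Complex.I - h) * X x) -
      (Real.exp (-U (x + h • w)) / Z) • Complex.exp (s * Complex.I * X (x + h • w)) =
      ((Real.exp (-U (x + h • w)) / Z * (Real.exp θ - 1) : ℝ) : ℂ) *
        Complex.exp (s * Complex.I * X (x + h • w)) := by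
    have hXs : X (x + h • w) = X x + h * τ := by simp only [hX, hT]; ring
    have e1 : Complex.exp (Complex.I * s * h * τ - h ^ 2 * τ / 2) * Complex.exp (-U x) *
        Complex.exp ((s * Complex.I - h) * X x) =
        Complex.exp (-U (x + h • w)) * Complex.exp θ *
          Complex.exp (s * Complex.I * (X x + h * τ)) := by
      simp only [← Complex.exp_add]
      congr 1
      simp only [hθ, hX]
      push_cast
      ring
    rw [hXs]
    simp only [Complex.real_smul]
    push_cast
    linear_combination (1 / (Z : ℂ)) * e1
  rw [hfac, norm_mul, Complex.norm_exp, Complex.norm_real, Real.norm_eq_abs, abs_mul,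
    abs_of_pos (div_pos (Real.exp_pos _) hZ0)]
  have hre : (s * Complex.I * X (x + h • w) : ℂ).re = 0 := by simp
  rw [hre, Real.exp_zero, mul_one, mul_comm]
  have h1 : |Real.exp θ - 1| ≤ Real.exp (|h| * ε) - 1 := by
    have h2 : Real.exp θ ≤ Real.exp (|h| * ε) := Real.exp_le_exp.2 (abs_le.1 (hshift h x)).2
    have h3 : Real.exp (-(|h| * ε)) ≤ Real.exp θ :=
      Real.exp_le_exp.2 (abs_le.1 (hshift h x)).1
    have h4 : 2 ≤ Real.exp (|h| * ε) + Real.exp (-(|h| * ε)) := by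
      have := Real.add_one_le_exp (|h| * ε)
      have := Real.add_one_le_exp (-(|h| * ε))
      linarith
    rw [abs_le]
    constructor <;> linarith
  have := div_pos (Real.exp_pos (-U (x + h • w))) hZ0
  gcongr

/-- If translation by `h • w` changes the potential `U` by `h (T - m) + h² τ / 2`, up to an error
`ε |h|`, then the law of `T` under the density `exp (-U)` is close to `N(m, τ)`. -/
theorem norm_charFun_map_tilted_sub_le (hU : Integrable (fun x => Real.exp (-U x)) μ)
    (hTm : Measurable T) (hτ : 0 ≤ τ)
    (hT : ∀ (h : ℝ) x, T (x + h • w) = T x + h * τ)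
    (hshift : ∀ (h : ℝ) x, |U (x + h • w) - U x - h * (T x - m) - h ^ 2 * τ / 2| ≤ |h| * ε)
    (s : ℝ) :
    ‖charFun ((μ.tilted fun x => -U x).map T) s -
      Complex.exp (Complex.I * s * m - τ * s ^ 2 / 2)‖ ≤ ε * |s| := by
  have hε : 0 ≤ ε := by simpa using (abs_nonneg _).trans (hshift 1 0)
  have hprob : IsProbabilityMeasure (μ.tilted fun x => -U x) := isProbabilityMeasure_tilted hU
  set ν := μ.tilted fun x => -U x with hν
  set X : E → ℝ := fun x => T x - m with hX
  have hXm : Measurable X := by fun_prop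
  have hset : integrableExpSet X ν = Set.univ := Set.eq_univ_of_forall fun h =>
    integrable_exp_mul_tilted_of_shift hU hTm hshift h
  have hM : ∀ z, DifferentiableAt ℂ (complexMGF X ν) z := fun z =>
    (hasDerivAt_complexMGF (by simp [hset])).differentiableAt
  -- The Gaussian transform is divided out: `G` is identically one when `X` is exactly `N(0, τ)`.
  set G : ℂ → ℂ := fun z => Complex.exp (-(z ^ 2 * τ / 2)) * complexMGF X ν z with hG
  have hGd : Differentiable ℂ G := fun z => by
    have := hM z
    fun_prop
  -- The shift estimate controls only horizontal increments of `G`. As `G` is entire, its derivative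
  -- is the same in every direction, so the bound may be integrated along the imaginary axis.
  have hG' : ∀ t : ℝ, ‖deriv G (t * Complex.I)‖ ≤ Real.exp (t ^ 2 * τ / 2) * ε := by
    intro t
    have hd : HasDerivAt (fun h : ℝ => G (t * Complex.I - h)) (-deriv G (t * Complex.I)) 0 := by
      have h1 : HasDerivAt (fun h : ℂ => G (t * Complex.I - h))
          (-deriv G (t * Complex.I)) ((0 : ℝ) : ℂ) := by
        have h2 : HasDerivAt G (deriv G (t * Complex.I)) (t * Complex.I - ((0 : ℝ) : ℂ)) := by
          simpa using (hGd (t * Complex.I)).hasDerivAt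
        simpa [Function.comp_def] using
          h2.comp ((0 : ℝ) : ℂ) ((hasDerivAt_id _).const_sub (t * Complex.I))
      exact h1.comp_ofReal
    have hb : ∀ h : ℝ, ‖G (t * Complex.I - h) - G (t * Complex.I)‖ ≤
        Real.exp (t ^ 2 * τ / 2) * (Real.exp (|h| * ε) - 1) := by
      intro h
      have h1 := norm_shift_sub_le hU hTm hT hshift t h
      have h2 : G (t * Complex.I - h) - G (t * Complex.I) = ((Real.exp (t ^ 2 * τ / 2) : ℝ) : ℂ) *
          (Complex.exp (Complex.I * t * h * τ - h ^ 2 * τ / 2) *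
            complexMGF X ν (t * Complex.I - h) - complexMGF X ν (t * Complex.I)) := by
        simp only [hG]
        push_cast
        rw [mul_sub, ← mul_assoc, ← Complex.exp_add]
        congr 3 <;> ring_nf <;> simp only [Complex.I_sq] <;> ring
      rw [h2, norm_mul, Complex.norm_real, Real.norm_eq_abs, Real.abs_exp]
      gcongr
    -- The increments are Lipschitz at the origin on the ball of radius `d`, with a constant that
    -- becomes sharp as `d → 0`.
    have hlim : Tendsto (fun d : ℝ => Real.exp (t ^ 2 * τ / 2) * (ε * Real.exp (d * ε)))
        (𝓝[>] 0) (𝓝 (Real.exp (t ^ 2 * τ / 2) * ε)) := by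
      have : Continuous fun d : ℝ => Real.exp (t ^ 2 * τ / 2) * (ε * Real.exp (d * ε)) := by
        fun_prop
      simpa using (this.tendsto 0).mono_left nhdsWithin_le_nhds
    refine ge_of_tendsto hlim ?_
    filter_upwards [self_mem_nhdsWithin] with d hd0
    rw [← norm_neg]
    refine hd.le_of_lip' (by positivity) ?_
    filter_upwards [Metric.ball_mem_nhds (0 : ℝ) hd0] with h hh
    rw [Metric.mem_ball, dist_zero_right, Real.norm_eq_abs] at hh
    have h3 : Real.exp (|h| * ε) - 1 ≤ ε * Real.exp (d * ε) * |h| := by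
      have h4 : Real.exp (|h| * ε) - 1 ≤ |h| * ε * Real.exp (|h| * ε) := by
        have := Real.add_one_le_exp (-(|h| * ε))
        have h5 : Real.exp (-(|h| * ε)) * Real.exp (|h| * ε) = 1 := by
          rw [← Real.exp_add]; simp
        nlinarith [Real.exp_pos (|h| * ε)]
      have h6 : Real.exp (|h| * ε) ≤ Real.exp (d * ε) := by gcongr
      have h7 : 0 ≤ |h| * ε := by positivity
      nlinarith
    have := hb h
    simp only [Complex.ofReal_zero, sub_zero, Real.norm_eq_abs]
    refine this.trans ?_
    rw [mul_assoc]
    gcongr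
  have hmain : ‖G (s * Complex.I) - G ((0 : ℝ) * Complex.I)‖ ≤
      Real.exp (s ^ 2 * τ / 2) * ε * ‖s - 0‖ := by
    refine (convex_uIcc (0 : ℝ) s).norm_image_sub_le_of_norm_hasDerivWithin_le
      (f := fun t : ℝ => G (t * Complex.I)) (f' := fun t => deriv G (t * Complex.I) * Complex.I)
      (fun t _ => ?_) (fun t ht => ?_) Set.left_mem_uIcc Set.right_mem_uIcc
    · have h1 : HasDerivAt (fun z : ℂ => G (z * Complex.I))
          (deriv G (t * Complex.I) * Complex.I) (t : ℂ) := by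
        simpa [Function.comp_def] using (hGd (t * Complex.I)).hasDerivAt.comp (t : ℂ)
          ((hasDerivAt_id (t : ℂ)).mul_const Complex.I)
      exact h1.comp_ofReal.hasDerivWithinAt
    · rw [norm_mul, Complex.norm_I, mul_one]
      refine (hG' t).trans ?_
      have : t ^ 2 ≤ s ^ 2 := by
        rw [sq_le_sq]
        rcases Set.mem_uIcc.1 ht with h | h
        · rw [abs_of_nonneg h.1, abs_of_nonneg (h.1.trans h.2)]; exact h.2
        · rw [abs_of_nonpos h.2, abs_of_nonpos (h.1.trans h.2)]; linarith [h.1]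
      gcongr
  have hG0 : G ((0 : ℝ) * Complex.I) = 1 := by simp [hG, complexMGF]
  have hGs : G (s * Complex.I) =
      Complex.exp (s ^ 2 * τ / 2) * complexMGF X ν (s * Complex.I) := by
    simp only [hG]
    congr 2
    rw [mul_pow, Complex.I_sq]
    ring
  have hchar : charFun (ν.map T) s =
      Complex.exp (Complex.I * s * m) * complexMGF X ν (s * Complex.I) := by
    rw [← complexMGF_mul_I hTm.aemeasurable, complexMGF, complexMGF, ← integral_const_mul]
    congr 1 with x
    rw [← Complex.exp_add]
    congr 1
    simp only [hX]
    push_cast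
    ring
  have hfin : charFun (ν.map T) s - Complex.exp (Complex.I * s * m - τ * s ^ 2 / 2) =
      Complex.exp (Complex.I * s * m - τ * s ^ 2 / 2) *
        (G (s * Complex.I) - G ((0 : ℝ) * Complex.I)) := by
    rw [hG0, hGs, hchar, mul_sub, mul_one, ← mul_assoc, ← Complex.exp_add]
    congr 3
    ring
  rw [hfin, norm_mul, Complex.norm_exp]
  have hre : (Complex.I * s * m - τ * s ^ 2 / 2 : ℂ).re = -(s ^ 2 * τ / 2) := by
    have : (τ * s ^ 2 / 2 : ℂ) = ((τ * s ^ 2 / 2 : ℝ) : ℂ) := by push_cast; rfl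
    rw [Complex.sub_re, this, Complex.ofReal_re]
    simp
    ring
  rw [hre]
  calc _ ≤ Real.exp (-(s ^ 2 * τ / 2)) * (Real.exp (s ^ 2 * τ / 2) * ε * ‖s - 0‖) := by gcongr
    _ = ε * |s| := by
      rw [← mul_assoc, ← mul_assoc, ← Real.exp_add]
      simp

end ApproxShift

/-! ### From characteristic functions to the bounded Lipschitz metric -/

section BoundedLipschitz

/-- Adding one to `g` makes it nonnegative, so the layer-cake formula applies. Thickening a
superlevel set of a 1-Lipschitz function by `ε` costs `ε` in level, and the additive Lévy–Prokhorov
term costs `ε ‖f‖ ≤ 2 ε`. -/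
lemma integral_sub_le_of_levyProkhorovEDist_lt (P Q : Measure ℝ) [IsProbabilityMeasure P]
    [IsProbabilityMeasure Q] {ε : ℝ} (hε : 0 < ε)
    (hPQ : levyProkhorovEDist P Q < ENNReal.ofReal ε) {g : ℝ → ℝ} (hg : InBLUnitBall g) :
    ∫ x, g x ∂P - ∫ x, g x ∂Q ≤ 3 * ε := by
  obtain ⟨M, L, hM, hL, hML⟩ := hg
  have hM1 : (M : ℝ) ≤ 1 := by exact_mod_cast le_self_add.trans hML
  have hL1 : L ≤ 1 := le_add_self.trans hML
  have hg1 : ∀ x, |g x| ≤ 1 := fun x => (hM x).trans hM1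
  let f : BoundedContinuousFunction ℝ ℝ := BoundedContinuousFunction.ofNormedAddCommGroup
    (fun x => g x + 1) (hL.continuous.add continuous_const) 2 fun x => by
      rw [Real.norm_eq_abs, abs_le]
      have := abs_le.1 (hg1 x)
      constructor <;> linarith
  have hf : ∀ x, f x = g x + 1 := fun _ => rfl
  have hfn : ‖f‖ ≤ 2 := BoundedContinuousFunction.norm_ofNormedAddCommGroup_le _ (by norm_num) _
  have hf0 : ∀ x, 0 ≤ f x := fun x => by rw [hf]; linarith [(abs_le.1 (hg1 x)).1]
  have h1 := BoundedContinuousFunction.integral_le_of_levyProkhorovEDist_lt P Q hε hPQ f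
    (ae_of_all _ hf0)
  have hanti : Antitone fun t : ℝ => Q.real {a | t ≤ f a + ε} := fun s t hst =>
    measureReal_mono fun _ h => hst.trans h
  have hint : ∀ b : ℝ, IntegrableOn (fun t : ℝ => Q.real {a | t ≤ f a + ε}) (Set.Ioc 0 b) :=
    fun b => Measure.integrableOn_of_bounded (M := 1) measure_Ioc_lt_top.ne
      hanti.measurable.aestronglyMeasurable (ae_of_all _ fun t => by
        rw [Real.norm_eq_abs, abs_of_nonneg measureReal_nonneg]; exact measureReal_le_one)
  have h2 : ∫ t in Set.Ioc 0 ‖f‖, Q.real (Metric.thickening ε {a | t ≤ f a}) ≤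
      ∫ t in Set.Ioc 0 (‖f‖ + ε), Q.real {a | t ≤ f a + ε} := by
    refine (setIntegral_mono_of_nonneg (fun _ _ => measureReal_nonneg)
      (fun t _ => measureReal_mono fun x hx => ?_) (hint ‖f‖)).trans (setIntegral_mono_set
      (hint (‖f‖ + ε)) (ae_of_all _ fun t => measureReal_nonneg)
      (Set.Ioc_subset_Ioc_right (by linarith)).eventuallyLE)
    obtain ⟨y, hy, hxy⟩ := Metric.mem_thickening_iff.1 hx
    have h := (hL.weaken hL1).dist_le_mul y x
    rw [Real.dist_eq, NNReal.coe_one, one_mul, dist_comm] at h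
    simp only [Set.mem_ofPred_eq, hf] at hy ⊢
    linarith [(abs_le.1 h).2]
  have hfi : Integrable f Q := f.integrable Q
  have h3 : ∫ t in Set.Ioc 0 (‖f‖ + ε), Q.real {a | t ≤ f a + ε} = ∫ x, (f x + ε) ∂Q := by
    refine (Integrable.integral_eq_integral_Ioc_meas_le (f := fun x => f x + ε)
      (hfi.add (integrable_const ε)) (ae_of_all _ fun x => ?_) (ae_of_all _ fun x => ?_)).symm
    · exact add_nonneg (hf0 x) hε.le
    · exact add_le_add_left (f.apply_le_norm x) ε
  have hgi : ∀ R : Measure ℝ, [IsProbabilityMeasure R] → Integrable g R := fun R _ =>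
    Integrable.of_bound hL.continuous.aestronglyMeasurable 1 (ae_of_all _ hg1)
  have h4 : ∫ x, f x ∂P = ∫ x, g x ∂P + 1 := by
    simp only [hf]
    rw [integral_add (hgi P) (integrable_const _)]
    simp
  have h5 : ∫ x, (f x + ε) ∂Q = ∫ x, g x ∂Q + 1 + ε := by
    simp only [hf]
    rw [integral_add (f := fun x => g x + 1) ((hgi Q).add (integrable_const _))
        (integrable_const _),
      integral_add (hgi Q) (integrable_const _)]
    simp
  nlinarith [norm_nonneg f]

lemma blDist_le_of_levyProkhorovEDist_lt (P Q : Measure ℝ) [IsProbabilityMeasure P]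
    [IsProbabilityMeasure Q] {ε : ℝ} (hε : 0 < ε)
    (hPQ : levyProkhorovEDist P Q < ENNReal.ofReal ε) : blDist P Q ≤ 3 * ε := by
  refine Real.sSup_le ?_ (by positivity)
  rintro r ⟨g, hg, rfl⟩
  rw [abs_sub_le_iff]
  exact ⟨integral_sub_le_of_levyProkhorovEDist_lt P Q hε hPQ hg,
    integral_sub_le_of_levyProkhorovEDist_lt Q P hε (by rwa [levyProkhorovEDist_comm]) hg⟩

lemma blDist_nonneg (P Q : Measure ℝ) : 0 ≤ blDist P Q := by
  refine Real.sSup_nonneg ?_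
  rintro r ⟨g, _, rfl⟩
  exact abs_nonneg _

/-- Bounded Lipschitz closeness to a centred Gaussian law follows from closeness of the
characteristic functions, uniformly over bounded variances. -/
theorem exists_forall_blDist_gaussianReal_le (B : ℝ) {δ : ℝ} (hδ : 0 < δ) :
    ∃ η : ℝ, 0 < η ∧ ∀ (P : Measure ℝ) [IsProbabilityMeasure P] (v : ℝ≥0), v ≤ B →
      (∀ s : ℝ, ‖charFun P s - Complex.exp (-(v * s ^ 2 / 2))‖ ≤ η * (|s| + s ^ 2)) →
      blDist P (gaussianReal 0 v) ≤ δ := by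
  -- Counterexamples for `η = 1 / (k + 1)` have variances in a compact interval. Along a subsequence
  -- these converge to some `u`, and by Lévy's continuity theorem both sequences of laws converge to
  -- `N(0, u)`.
  by_contra! hcon
  have hpos : ∀ k : ℕ, (0 : ℝ) < 1 / (k + 1) := fun k => Nat.one_div_pos_of_nat
  choose P hP v hvB hchar hdist using fun k : ℕ => hcon (1 / ((k : ℝ) + 1)) (hpos k)
  have hvmem : ∀ k, v k ∈ Set.Icc (0 : ℝ≥0) B.toNNReal := fun k =>
    ⟨zero_le, NNReal.le_toNNReal_of_coe_le (hvB k)⟩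
  obtain ⟨u, -, φ, hφ, hu⟩ := isCompact_Icc.tendsto_subseq hvmem
  have hucoe : Tendsto (fun k => ((v (φ k) : ℝ≥0) : ℝ)) atTop (𝓝 u) :=
    (NNReal.continuous_coe.tendsto u).comp hu
  have hgauss : ∀ s : ℝ, Tendsto (fun k => Complex.exp (-((v (φ k) : ℝ) * s ^ 2 / 2))) atTop
      (𝓝 (Complex.exp (-((u : ℝ) * s ^ 2 / 2)))) := fun s => by
    have hc : Continuous fun x : ℝ => Complex.exp (-((x : ℂ) * s ^ 2 / 2)) := by fun_prop
    exact (hc.tendsto u).comp hucoe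
  have hcharg : ∀ (x : ℝ≥0) (s : ℝ),
      charFun (gaussianReal 0 x) s = Complex.exp (-((x : ℝ) * s ^ 2 / 2)) := fun x s => by
    rw [charFun_gaussianReal]
    simp
  let PP : ℕ → ProbabilityMeasure ℝ := fun k => ⟨P (φ k), hP (φ k)⟩
  let QQ : ℕ → ProbabilityMeasure ℝ := fun k => ⟨gaussianReal 0 (v (φ k)), inferInstance⟩
  let R : ProbabilityMeasure ℝ := ⟨gaussianReal 0 u, inferInstance⟩
  have hQ : Tendsto QQ atTop (𝓝 R) := by
    refine ProbabilityMeasure.tendsto_of_tendsto_charFun fun s => ?_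
    simp only [QQ, R, ProbabilityMeasure.coe_mk, hcharg]
    exact hgauss s
  have hP' : Tendsto PP atTop (𝓝 R) := by
    refine ProbabilityMeasure.tendsto_of_tendsto_charFun fun s => ?_
    simp only [PP, R, ProbabilityMeasure.coe_mk, hcharg]
    have h0 : Tendsto (fun k => 1 / (((φ k : ℕ) : ℝ) + 1) * (|s| + s ^ 2)) atTop (𝓝 0) := by
      have := (tendsto_one_div_add_atTop_nhds_zero_nat (𝕜 := ℝ)).comp hφ.tendsto_atTop
      simpa using this.mul_const (|s| + s ^ 2)
    have h1 := squeeze_zero_norm (fun k => hchar (φ k) s) h0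
    simpa using h1.add (hgauss s)
  have hlp : ∀ S : ℕ → ProbabilityMeasure ℝ, Tendsto S atTop (𝓝 R) →
      ∀ᶠ k in atTop, levyProkhorovEDist (S k : Measure ℝ) R < ENNReal.ofReal (δ / 6 / 2) := by
    intro S hS
    have h1 := (LevyProkhorov.continuous_ofMeasure_probabilityMeasure.tendsto R).comp hS
    have h2 := (EMetric.tendsto_nhds.1 h1) (ENNReal.ofReal (δ / 6 / 2)) (by positivity)
    filter_upwards [h2] with k hk
    exact hk
  obtain ⟨k, hk1, hk2⟩ := ((hlp PP hP').and (hlp QQ hQ)).exists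
  -- The factor 3 lost in the comparison of metrics turns `δ / 6` into `δ / 2`, contradicting a
  -- distance above `δ`.
  have hlt : levyProkhorovEDist (P (φ k)) (gaussianReal 0 (v (φ k))) < ENNReal.ofReal (δ / 6) := by
    refine (levyProkhorovEDist_triangle _ (R : Measure ℝ) _).trans_lt ?_
    rw [levyProkhorovEDist_comm (R : Measure ℝ)]
    have := ENNReal.add_lt_add hk1 hk2
    rwa [← ENNReal.ofReal_add (by positivity) (by positivity), add_halves] at this
  have := blDist_le_of_levyProkhorovEDist_lt _ _ (by positivity) hlt
  linarith [hdist (φ k)]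

end BoundedLipschitz

/-! ### Cell averages as an orthogonal projection -/

section Cells

variable {n K : ℕ}

/-- The number of design points with label `k`. -/
def cellCount (κ : Fin n → Fin K) (k : Fin K) : ℝ := ((Finset.univ.filter fun i => κ i = k).card : ℝ)

/-- The average of `y` over the design points with label `k`. -/
def cellMean (κ : Fin n → Fin K) (y : Fin n → ℝ) (k : Fin K) : ℝ :=
  (∑ i with κ i = k, y i) / cellCount κ k

lemma sum_mul_comp_label (κ : Fin n → Fin K) (y : Fin n → ℝ) (b : Fin K → ℝ) :
    ∑ i, y i * b (κ i) = ∑ k, (∑ i with κ i = k, y i) * b k := by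
  rw [← Finset.sum_fiberwise _ κ]
  refine Finset.sum_congr rfl fun k _ => ?_
  rw [Finset.sum_mul]
  exact Finset.sum_congr rfl fun i hi => by rw [(Finset.mem_filter.1 hi).2]

lemma sum_comp_label (κ : Fin n → Fin K) (b : Fin K → ℝ) :
    ∑ i, b (κ i) = ∑ k, cellCount κ k * b k := by
  have := sum_mul_comp_label κ (fun _ => 1) b
  simpa [cellCount] using this

lemma cellCount_mul_cellMean {κ : Fin n → Fin K} (hN : ∀ k, 0 < cellCount κ k) (y : Fin n → ℝ)
    (k : Fin K) : cellCount κ k * cellMean κ y k = ∑ i with κ i = k, y i := by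
  rw [cellMean, mul_div_cancel₀ _ (hN k).ne']

lemma sum_mul_comp_label_eq_sum_cellMean {κ : Fin n → Fin K} (hN : ∀ k, 0 < cellCount κ k)
    (y : Fin n → ℝ) (b : Fin K → ℝ) :
    ∑ i, y i * b (κ i) = ∑ k, cellCount κ k * cellMean κ y k * b k := by
  rw [sum_mul_comp_label]
  exact Finset.sum_congr rfl fun k _ => by rw [cellCount_mul_cellMean hN]

/-- Orthogonality of the projection: a step function sees `y` only through its cell averages. -/
lemma sum_mul_comp_label_eq {κ : Fin n → Fin K} (hN : ∀ k, 0 < cellCount κ k)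
    (y : Fin n → ℝ) (b : Fin K → ℝ) :
    ∑ i, y i * b (κ i) = ∑ i, cellMean κ y (κ i) * b (κ i) := by
  rw [sum_mul_comp_label_eq_sum_cellMean hN,
    sum_comp_label κ fun k => cellMean κ y k * b k]
  exact Finset.sum_congr rfl fun k _ => by ring

/-- `κ` assigns to each design point the cell that contains it. -/
def IsLabel (n : ℕ) {K : ℕ} (Ω : Fin K → Set ℝ) (κ : Fin n → Fin K) : Prop :=
  ∀ i k, design n i ∈ Ω k ↔ κ i = k

lemma design_mem_Icc (i : Fin n) : design n i ∈ Set.Icc (0 : ℝ) 1 := by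
  have hn : 0 < n := i.pos
  have hn' : (0 : ℝ) < n := by exact_mod_cast hn
  refine ⟨by unfold design; positivity, ?_⟩
  rw [design, div_le_one hn']
  exact_mod_cast i.isLt

lemma IsIntervalPartition.exists_isLabel {Ω : Fin K → Set ℝ} (h : IsIntervalPartition Ω) (n : ℕ) :
    ∃ κ : Fin n → Fin K, IsLabel n Ω κ := by
  have h1 : ∀ i : Fin n, ∃ k, design n i ∈ Ω k := fun i => by
    rw [← Set.mem_iUnion, h.cover]
    exact design_mem_Icc i
  choose κ hκ using h1
  refine ⟨κ, fun i k => ⟨fun hk => ?_, fun hk => hk ▸ hκ i⟩⟩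
  by_contra hne
  exact Set.disjoint_left.1 (h.disjoint hne) (hκ i) hk

variable {Ω : Fin K → Set ℝ} {κ : Fin n → Fin K}

lemma IsLabel.indicator_apply (hκ : IsLabel n Ω κ) (k : Fin K) (b : ℝ) (i : Fin n) :
    (Ω k).indicator (fun _ => b) (design n i) = if κ i = k then b else 0 := by
  classical
  rw [Set.indicator_apply]
  exact if_congr (hκ i k) rfl rfl

lemma IsLabel.stepFun_design (hκ : IsLabel n Ω κ) (β : Fin K → ℝ) (i : Fin n) :
    stepFun Ω β (design n i) = β (κ i) := by
  simp [stepFun, hκ.indicator_apply]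

lemma IsLabel.cellMass_eq (hκ : IsLabel n Ω κ) (k : Fin K) :
    cellMass n (Ω k) = cellCount κ k / n := by
  simp only [cellMass, hκ.indicator_apply, cellCount, Finset.card_filter]
  push_cast
  ring

lemma IsLabel.projCoef_eq (hκ : IsLabel n Ω κ) (g : ℝ → ℝ) (k : Fin K) :
    projCoef n Ω g k = cellMean κ (fun i => g (design n i)) k := by
  rcases Nat.eq_zero_or_pos n with rfl | hn
  · simp [projCoef, cellMean]
  have hn' : (n : ℝ) ≠ 0 := by positivity
  simp only [projCoef, hκ.indicator_apply, hκ.cellMass_eq, cellMean, Finset.sum_filter,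
    Finset.sum_div]
  refine Finset.sum_congr rfl fun i _ => ?_
  split_ifs
  · by_cases hN : cellCount κ k = 0
    · simp [hN]
    · field_simp
  · simp

lemma IsLabel.proj_design (hκ : IsLabel n Ω κ) (g : ℝ → ℝ) (i : Fin n) :
    proj n Ω g (design n i) = cellMean κ (fun i => g (design n i)) (κ i) := by
  rw [proj, hκ.stepFun_design, hκ.projCoef_eq]

/-- Self-adjointness moves the projection from `f₀` to `a`, after which `f₀` cancels against the
noise. What is left pairs `a^K / √n` with the very residuals that enter the likelihood. -/
lemma IsLabel.sqrt_mul_psi_sub_psiHat (hκ : IsLabel n Ω κ) (hN : ∀ k, 0 < cellCount κ k)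
    (f₀ a : ℝ → ℝ) (β : Fin K → ℝ) (Y : Fin n → ℝ) :
    Real.sqrt n * (psi n a (stepFun Ω β) - psiHat n Ω f₀ a Y) =
      ∑ i, cellMean κ (fun i => a (design n i)) (κ i) / Real.sqrt n * (β (κ i) - Y i) := by
  rcases Nat.eq_zero_or_pos n with rfl | hn
  · simp
  have hn' : (0 : ℝ) < n := by exact_mod_cast hn
  have hs : 0 < Real.sqrt n := Real.sqrt_pos.2 hn'
  have hss : Real.sqrt n * Real.sqrt n = n := Real.mul_self_sqrt hn'.le
  simp only [psi, innerL, psiHat, W, hκ.stepFun_design, hκ.proj_design]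
  set A := cellMean κ fun i => a (design n i) with hA
  set F := cellMean κ fun i => f₀ (design n i) with hF
  have h1 : ∑ i, a (design n i) * β (κ i) = ∑ i, A (κ i) * β (κ i) :=
    sum_mul_comp_label_eq hN _ _
  have h2 : ∑ i, a (design n i) * F (κ i) = ∑ i, A (κ i) * f₀ (design n i) := by
    rw [sum_mul_comp_label_eq hN (fun i => a (design n i)) F]
    rw [← Finset.sum_congr rfl fun i _ => mul_comm (f₀ (design n i)) (A (κ i)),
      ← Finset.sum_congr rfl fun i _ => mul_comm (F (κ i)) (A (κ i))]
    exact (sum_mul_comp_label_eq hN (fun i => f₀ (design n i)) A).symm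
  have h3 : ∑ i, Real.sqrt n * (Y i - f₀ (design n i)) * A (κ i) =
      Real.sqrt n * (∑ i, A (κ i) * Y i - ∑ i, A (κ i) * f₀ (design n i)) := by
    rw [← Finset.sum_sub_distrib, Finset.mul_sum]
    exact Finset.sum_congr rfl fun i _ => by ring
  have h4 : ∑ i, A (κ i) / Real.sqrt n * (β (κ i) - Y i) =
      (∑ i, A (κ i) * β (κ i) - ∑ i, A (κ i) * Y i) / Real.sqrt n := by
    rw [← Finset.sum_sub_distrib, Finset.sum_div]
    exact Finset.sum_congr rfl fun i _ => by ring
  rw [h1, h2, h3, h4]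
  have hn2 : (n : ℝ) = Real.sqrt n ^ 2 := by rw [sq, hss]
  rw [show (1 / (n : ℝ)) = 1 / Real.sqrt n ^ 2 by rw [← hn2]]
  field_simp
  ring

/-- The bias pairs the residual of `a` with that of `f₀`, so the two approximation rates multiply.
-/
lemma IsLabel.sqrt_mul_psiHat_sub_psiN (hκ : IsLabel n Ω κ) (hN : ∀ k, 0 < cellCount κ k)
    (f₀ a : ℝ → ℝ) (Y : Fin n → ℝ) :
    Real.sqrt n * (psiHat n Ω f₀ a Y - psiN n f₀ a Y) =
      1 / Real.sqrt n * ∑ i, (a (design n i) - cellMean κ (fun i => a (design n i)) (κ i)) *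
        (cellMean κ (fun i => f₀ (design n i)) (κ i) - f₀ (design n i)) +
      ∑ i, (cellMean κ (fun i => a (design n i)) (κ i) - a (design n i)) / Real.sqrt n *
        (Y i - f₀ (design n i)) := by
  rcases Nat.eq_zero_or_pos n with rfl | hn
  · simp
  have hn' : (0 : ℝ) < n := by exact_mod_cast hn
  have hs : 0 < Real.sqrt n := Real.sqrt_pos.2 hn'
  have hss : Real.sqrt n * Real.sqrt n = n := Real.mul_self_sqrt hn'.le
  simp only [psi, innerL, psiHat, psiN, W, hκ.proj_design]
  set A := cellMean κ fun i => a (design n i) with hA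
  set F := cellMean κ fun i => f₀ (design n i) with hF
  have h0 : ∑ i, A (κ i) * F (κ i) = ∑ i, A (κ i) * f₀ (design n i) := by
    rw [← Finset.sum_congr rfl fun i _ => mul_comm (f₀ (design n i)) (A (κ i)),
      ← Finset.sum_congr rfl fun i _ => mul_comm (F (κ i)) (A (κ i))]
    exact (sum_mul_comp_label_eq hN (fun i => f₀ (design n i)) A).symm
  have h1 : ∑ i, (a (design n i) - A (κ i)) * (F (κ i) - f₀ (design n i)) =
      ∑ i, a (design n i) * F (κ i) - ∑ i, a (design n i) * f₀ (design n i) := by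
    have : ∑ i, (a (design n i) - A (κ i)) * (F (κ i) - f₀ (design n i)) =
        ∑ i, a (design n i) * F (κ i) - ∑ i, a (design n i) * f₀ (design n i) -
          (∑ i, A (κ i) * F (κ i) - ∑ i, A (κ i) * f₀ (design n i)) := by
      simp only [← Finset.sum_sub_distrib]
      exact Finset.sum_congr rfl fun i _ => by ring
    rw [this, h0]
    ring
  have h3 : ∀ g : Fin n → ℝ, ∑ i, Real.sqrt n * (Y i - f₀ (design n i)) * g i =
      Real.sqrt n * ∑ i, (Y i - f₀ (design n i)) * g i := by
    intro g
    rw [Finset.mul_sum]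
    exact Finset.sum_congr rfl fun i _ => by ring
  have h4 : ∑ i, (A (κ i) - a (design n i)) / Real.sqrt n * (Y i - f₀ (design n i)) =
      (∑ i, (Y i - f₀ (design n i)) * A (κ i) -
        ∑ i, (Y i - f₀ (design n i)) * a (design n i)) / Real.sqrt n := by
    rw [← Finset.sum_sub_distrib, Finset.sum_div]
    exact Finset.sum_congr rfl fun i _ => by ring
  rw [h1, h3, h3, h4]
  have hn2 : (n : ℝ) = Real.sqrt n ^ 2 := by rw [sq, hss]
  rw [show (1 / (n : ℝ)) = 1 / Real.sqrt n ^ 2 by rw [← hn2]]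
  field_simp
  ring

lemma IsLabel.logLik_stepFun (hκ : IsLabel n Ω κ) (Y : Fin n → ℝ) (β : Fin K → ℝ) :
    logLik n Y (stepFun Ω β) =
      -((n : ℝ) / 2) * Real.log (2 * Real.pi) - ∑ i, (Y i - β (κ i)) ^ 2 / 2 := by
  simp only [logLik, hκ.stepFun_design]

/-- Pythagoras for the projection. -/
lemma normSqL_sub_sum_cellMean_sq (hN : ∀ k, 0 < cellCount κ k) (a : ℝ → ℝ) :
    normSqL n a - ∑ i, (cellMean κ (fun i => a (design n i)) (κ i) / Real.sqrt n) ^ 2 =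
      1 / n * ∑ i, (a (design n i) - cellMean κ (fun i => a (design n i)) (κ i)) ^ 2 := by
  set A := cellMean κ fun i => a (design n i) with hA
  have h1 := sum_mul_comp_label_eq hN (fun i => a (design n i)) A
  have h2 : ∑ i, (a (design n i) - A (κ i)) ^ 2 = ∑ i, a (design n i) ^ 2 -
      2 * ∑ i, a (design n i) * A (κ i) + ∑ i, A (κ i) * A (κ i) := by
    rw [Finset.mul_sum, ← Finset.sum_sub_distrib, ← Finset.sum_add_distrib]
    exact Finset.sum_congr rfl fun i _ => by ring
  have h3 : ∑ i, (A (κ i) / Real.sqrt n) ^ 2 = 1 / n * ∑ i, A (κ i) * A (κ i) := by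
    rw [Finset.mul_sum]
    exact Finset.sum_congr rfl fun i _ => by
      rw [div_pow, Real.sq_sqrt (Nat.cast_nonneg n)]; ring
  rw [h2, h3, h1, normSqL]
  ring

end Cells

/-! ### Priors as exponential tiltings of Lebesgue measure -/

section Tilting

/-- Used to pull the likelihood back to latent coordinates, where the reference measure is
translation invariant. -/
lemma map_tilted_comp {α β : Type*} [MeasurableSpace α] [MeasurableSpace β] (μ : Measure α)
    {A : α → β} (hA : Measurable A) {g : β → ℝ} (hg : Measurable g) :
    (μ.map A).tilted g = (μ.tilted fun x => g (A x)).map A := by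
  ext s hs
  rw [tilted_apply' _ _ hs, Measure.map_apply hA hs, tilted_apply' _ _ (hA hs),
    setLIntegral_map hs (by fun_prop) hA,
    integral_map hA.aemeasurable (by fun_prop : Measurable fun x => Real.exp (g x)).aestronglyMeasurable]

lemma integrable_exp_sum {K : ℕ} {f : ℝ → ℝ} (hf : Integrable fun x => Real.exp (f x)) :
    Integrable fun β : Fin K → ℝ => Real.exp (∑ k, f (β k)) := by
  simp_rw [Real.exp_sum]
  exact Integrable.fintype_prod (f := fun _ x => Real.exp (f x)) fun _ => hf

lemma pi_tilted {K : ℕ} {f : ℝ → ℝ} (hf : Integrable fun x => Real.exp (f x)) :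
    (Measure.pi fun _ : Fin K => (volume : Measure ℝ).tilted f) =
      (volume : Measure (Fin K → ℝ)).tilted fun β => ∑ k, f (β k) := by
  have : IsProbabilityMeasure ((volume : Measure ℝ).tilted f) := isProbabilityMeasure_tilted hf
  refine Measure.pi_eq fun s hs => ?_
  simp_rw [tilted_apply_eq_ofReal_integral]
  rw [← ENNReal.ofReal_prod_of_nonneg
    (fun k _ => integral_nonneg fun x => div_nonneg (Real.exp_pos _).le
      (integral_nonneg fun y => (Real.exp_pos _).le))]
  congr 1
  simp_rw [integral_div, Real.exp_sum]
  rw [volume_pi, Measure.restrict_pi_pi,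
    integral_fintype_prod_eq_prod (fun _ x => Real.exp (f x)),
    integral_fintype_prod_eq_prod (fun _ x => Real.exp (f x)), Finset.prod_div_distrib]

lemma integral_exp_neg_mul_abs {l : ℝ} (hl : 0 < l) :
    ∫ x : ℝ, Real.exp (-l * |x|) = 2 / l := by
  rw [integral_comp_abs (f := fun x => Real.exp (-l * x)), integral_exp_mul_Ioi (by linarith)]
  simp
  ring

lemma integrable_exp_neg_mul_abs {l : ℝ} (hl : 0 < l) :
    Integrable fun x : ℝ => Real.exp (-l * |x|) := by
  -- A non-integrable function has Bochner integral zero, which the computed value excludes.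
  by_contra h
  have := integral_exp_neg_mul_abs hl
  rw [integral_undef h] at this
  exact (div_pos two_pos hl).ne this

lemma laplaceReal_eq_tilted {l : ℝ} (hl : 0 < l) :
    laplaceReal l = (volume : Measure ℝ).tilted fun x => -l * |x| := by
  rw [laplaceReal, Measure.tilted, integral_exp_neg_mul_abs hl]
  congr with x
  congr 1
  field_simp

lemma laplacePrior_eq_tilted {l : ℝ} (hl : 0 < l) (K : ℕ) :
    laplacePrior l K = (volume : Measure (Fin K → ℝ)).tilted fun β => ∑ k, -l * |β k| := by
  rw [laplacePrior, laplaceReal_eq_tilted hl, pi_tilted (integrable_exp_neg_mul_abs hl)]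

lemma integrable_exp_neg_sq_div_two : Integrable fun x : ℝ => Real.exp (-(x ^ 2 / 2)) := by
  have := integrable_exp_neg_mul_sq (b := 1 / 2) (by norm_num)
  refine this.congr (ae_of_all _ fun x => ?_)
  simp only
  congr 1
  ring

lemma gaussianReal_zero_one_eq_tilted :
    gaussianReal 0 1 = (volume : Measure ℝ).tilted fun x => -(x ^ 2 / 2) := by
  have h : ∫ x : ℝ, Real.exp (-(x ^ 2 / 2)) = Real.sqrt (2 * Real.pi) := by
    have h1 := integral_gaussian (1 / 2)
    have h2 : (fun x : ℝ => Real.exp (-(x ^ 2 / 2))) = fun x => Real.exp (-(1 / 2) * x ^ 2) := by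
      ext x; congr 1; ring
    rw [h2, h1]
    congr 1
    ring
  rw [gaussianReal_of_var_ne_zero _ one_ne_zero, Measure.tilted, h]
  congr with x
  rw [gaussianPDF, gaussianPDFReal]
  congr 1
  simp only [NNReal.coe_one, mul_one, sub_zero, neg_div]
  exact (div_eq_inv_mul _ _).symm

-- In these whitened coordinates the potential is `∑ z_k² / 2`, and no inverse covariance appears.
open scoped MatrixOrder in
lemma gaussianPrior_eq_map {K : ℕ} (S : Matrix (Fin K) (Fin K) ℝ) :
    gaussianPrior S = ((volume : Measure (Fin K → ℝ)).tilted
      fun z => ∑ k, -(z k ^ 2 / 2)).map fun z => (CFC.sqrt S).mulVec z := by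
  rw [← pi_tilted integrable_exp_neg_sq_div_two, ← gaussianReal_zero_one_eq_tilted, gaussianPrior,
    multivariateGaussian, ← map_pi_eq_stdGaussian, Measure.map_map (by fun_prop) (by fun_prop),
    Measure.map_map (by fun_prop) (by fun_prop)]
  congr 1
  ext z k
  simp

end Tilting

/-! ### Posterior approximation at a fixed sample size -/

section FixedSampleSize

variable {n K : ℕ} {Ω : Fin K → Set ℝ} {κ : Fin n → Fin K}

/-- The direction `a^K / √n` in which the posterior is perturbed. -/
def tiltDir (κ : Fin n → Fin K) (a : ℝ → ℝ) (k : Fin K) : ℝ :=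
  cellMean κ (fun i => a (design n i)) k / Real.sqrt n

/-- Approximation of the posterior law of the functional by `N(m, τ)` for a prior that is the
image of the density `exp (-V)` under a linear map `A`, when the prior is almost invariant under
the shift `w`. -/
theorem charFun_posteriorPsi_of_shift (hκ : IsLabel n Ω κ) (hN : ∀ k, 0 < cellCount κ k)
    (f₀ a : ℝ → ℝ) (Y : Fin n → ℝ) (A : (Fin K → ℝ) →ₗ[ℝ] (Fin K → ℝ)) {V : (Fin K → ℝ) → ℝ}
    (hV : Integrable fun z => Real.exp (-V z)) {prior : Measure (Fin K → ℝ)}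
    (hprior : prior = (volume.tilted fun z => -V z).map A) {w : Fin K → ℝ} {τ m ε : ℝ}
    (hτ0 : 0 ≤ τ) (hτ : τ = ∑ i, tiltDir κ a (κ i) * A w (κ i))
    (hshift : ∀ (h : ℝ) z, |V (z + h • w) - V z -
      h * ((∑ i, (tiltDir κ a (κ i) - A w (κ i)) * (A z (κ i) - Y i)) - m) -
      h ^ 2 * (τ - ∑ i, A w (κ i) ^ 2) / 2| ≤ |h| * ε) :
    IsProbabilityMeasure (posteriorPsi n Ω f₀ a prior Y) ∧
      ∀ s : ℝ, ‖charFun (posteriorPsi n Ω f₀ a prior Y) s -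
        Complex.exp (Complex.I * s * m - τ * s ^ 2 / 2)‖ ≤ ε * |s| := by
  have hAm : Measurable A := (LinearMap.continuous_of_finiteDimensional A).measurable
  set q : (Fin K → ℝ) → ℝ := fun β =>
    -((n : ℝ) / 2) * Real.log (2 * Real.pi) - ∑ i, (Y i - β (κ i)) ^ 2 / 2 with hq
  have hqm : Measurable q := by fun_prop
  set T : (Fin K → ℝ) → ℝ := fun β => ∑ i, tiltDir κ a (κ i) * (β (κ i) - Y i) with hT
  have hTm : Measurable T := by fun_prop
  -- The likelihood is bounded, so it preserves integrability of the prior density.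
  have hU : Integrable fun z => Real.exp (-(V z - q (A z))) := by
    have hb := hV.bdd_mul (c := Real.exp (-((n : ℝ) / 2) * Real.log (2 * Real.pi)))
      (f := fun z => Real.exp (q (A z)))
      (by fun_prop : Measurable fun z => Real.exp (q (A z))).aestronglyMeasurable
      (ae_of_all _ fun z => by
        rw [Real.norm_eq_abs, Real.abs_exp, Real.exp_le_exp]
        have : 0 ≤ ∑ i, (Y i - A z (κ i)) ^ 2 / 2 := Finset.sum_nonneg fun i _ => by positivity
        simp only [hq]
        linarith)
    refine hb.congr (ae_of_all _ fun z => ?_)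
    simp only [← Real.exp_add]
    congr 1
    ring
  have hpost : posteriorPsi n Ω f₀ a prior Y =
      (volume.tilted fun z => -(V z - q (A z))).map fun z => T (A z) := by
    have h1 : (fun β => logLik n Y (stepFun Ω β)) = q := by
      ext β
      exact hκ.logLik_stepFun Y β
    have h2 : (fun β => Real.sqrt n * (psi n a (stepFun Ω β) - psiHat n Ω f₀ a Y)) = T := by
      ext β
      exact hκ.sqrt_mul_psi_sub_psiHat hN f₀ a β Y
    rw [posteriorPsi, stepPosterior, h1, h2, hprior, map_tilted_comp _ hAm hqm,
      tilted_tilted hV, Measure.map_map hTm hAm]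
    have h3 : ((fun z => -V z) + fun z => q (A z)) = fun z => -(V z - q (A z)) := by
      ext z
      simp only [Pi.add_apply]
      ring
    rw [h3]
    rfl
  rw [hpost]
  have hTA : Measurable fun z => T (A z) := hTm.comp hAm
  have : IsProbabilityMeasure (volume.tilted fun z => -(V z - q (A z))) :=
    isProbabilityMeasure_tilted hU
  refine ⟨Measure.isProbabilityMeasure_map hTA.aemeasurable, fun s => ?_⟩
  refine norm_charFun_map_tilted_sub_le (w := w) hU hTA hτ0 (fun h z => ?_) (fun h z => ?_) s
  · simp only [hT, hτ, map_add, map_smul, Pi.add_apply, Pi.smul_apply, smul_eq_mul, Finset.mul_sum]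
    rw [← Finset.sum_add_distrib]
    exact Finset.sum_congr rfl fun i _ => by ring
  · refine le_of_eq_of_le ?_ (hshift h z)
    congr 1
    -- Exact expansion of the likelihood. Its mismatch with `T` pairs the residuals with `tiltDir -
    -- A w`; this is what the change in `V` must compensate.
    have h1 : q (A (z + h • w)) - q (A z) + h * T (A z) =
        h * (∑ i, (tiltDir κ a (κ i) - A w (κ i)) * (A z (κ i) - Y i)) -
          h ^ 2 / 2 * ∑ i, A w (κ i) ^ 2 := by
      simp only [hT, hq, map_add, map_smul, Pi.add_apply, Pi.smul_apply, smul_eq_mul,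
        Finset.mul_sum]
      rw [← Finset.sum_sub_distrib, sub_sub_sub_cancel_left, ← Finset.sum_sub_distrib,
        ← Finset.sum_add_distrib]
      exact Finset.sum_congr rfl fun i _ => by ring
    linear_combination -h1

/-- Shifting by `tiltDir` itself makes the likelihood part exact. The potential `l ∑ |β_k|` is
Lipschitz, so only a linear defect remains. -/
theorem charFun_posteriorPsi_laplacePrior (hκ : IsLabel n Ω κ) (hN : ∀ k, 0 < cellCount κ k)
    (f₀ a : ℝ → ℝ) {l : ℝ} (hl : 0 < l) (Y : Fin n → ℝ) :
    IsProbabilityMeasure (posteriorPsi n Ω f₀ a (laplacePrior l K) Y) ∧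
      ∀ s : ℝ, ‖charFun (posteriorPsi n Ω f₀ a (laplacePrior l K) Y) s -
        Complex.exp (Complex.I * s * (0 : ℝ) - (∑ i, tiltDir κ a (κ i) ^ 2 : ℝ) * s ^ 2 / 2)‖ ≤
        (l * ∑ k, |tiltDir κ a k|) * |s| := by
  have hneg : ∀ β : Fin K → ℝ, ∑ k, -l * |β k| = -∑ k, l * |β k| := fun β => by simp
  refine charFun_posteriorPsi_of_shift (w := tiltDir κ a) hκ hN f₀ a Y LinearMap.id
    (V := fun β => ∑ k, l * |β k|) ?_ ?_ (Finset.sum_nonneg fun i _ => sq_nonneg _) ?_ ?_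
  · simp_rw [← hneg]
    exact integrable_exp_sum (integrable_exp_neg_mul_abs hl)
  · rw [laplacePrior_eq_tilted hl]
    simp_rw [← hneg]
    exact Measure.map_id.symm
  · exact Finset.sum_congr rfl fun i _ => by simp [sq]
  · intro h β
    simp only [LinearMap.id_apply, sub_self, zero_mul, Finset.sum_const_zero, mul_zero, sub_zero,
      zero_div, Pi.add_apply, Pi.smul_apply, smul_eq_mul]
    rw [← Finset.sum_sub_distrib, ← mul_assoc, Finset.mul_sum]
    refine (Finset.abs_sum_le_sum_abs _ _).trans (Finset.sum_le_sum fun k _ => ?_)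
    rw [← mul_sub, abs_mul, abs_of_pos hl]
    have := abs_abs_sub_abs_le (β k + h * tiltDir κ a k) (β k)
    rw [add_sub_cancel_left, abs_mul] at this
    nlinarith

open scoped MatrixOrder in
lemma mul_sum_sq_le_dotProduct_mulVec {S : Matrix (Fin K) (Fin K) ℝ} (hS : S.PosDef) {c : ℝ}
    (hc : ∀ k, c < hS.isHermitian.eigenvalues k) (r : Fin K → ℝ) :
    c * ∑ k, r k ^ 2 ≤ r ⬝ᵥ S.mulVec r := by
  have h1 : algebraMap ℝ (Matrix (Fin K) (Fin K) ℝ) c ≤ S := by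
    rw [algebraMap_le_iff_le_spectrum (a := S) (ha := hS.isHermitian)]
    intro x hx
    rw [hS.isHermitian.spectrum_real_eq_range_eigenvalues] at hx
    obtain ⟨k, rfl⟩ := hx
    exact (hc k).le
  have h2 := (Matrix.le_iff.1 h1).dotProduct_mulVec_nonneg r
  rw [Matrix.sub_mulVec, dotProduct_sub, Algebra.algebraMap_eq_smul_one, Matrix.smul_mulVec,
    Matrix.one_mulVec, dotProduct_smul] at h2
  simp only [star_trivial, smul_eq_mul] at h2
  have h3 : r ⬝ᵥ r = ∑ k, r k ^ 2 := Finset.sum_congr rfl fun k _ => by ring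
  rw [h3] at h2
  linarith

/-- With `ω = S r` the system says `N_k (v_k - ω_k) = r_k`: the likelihood mismatch of the shift `ω`
cancels the linear change `S⁻¹ ω = r` of the prior potential. -/
lemma exists_div_add_mulVec_eq {S : Matrix (Fin K) (Fin K) ℝ} (hS : S.PosDef) {N : Fin K → ℝ}
    (hN : ∀ k, 0 < N k) (v : Fin K → ℝ) :
    ∃ r : Fin K → ℝ, ∀ k, r k / N k + S.mulVec r k = v k := by
  have hD : (Matrix.diagonal fun k => (N k)⁻¹).PosDef :=
    Matrix.PosDef.diagonal fun k => inv_pos.2 (hN k)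
  have hu := (hD.add hS).isUnit
  refine ⟨((Matrix.diagonal fun k => (N k)⁻¹) + S)⁻¹.mulVec v, fun k => ?_⟩
  set r := ((Matrix.diagonal fun k => (N k)⁻¹) + S)⁻¹.mulVec v with hr
  have h1 : ((Matrix.diagonal fun k => (N k)⁻¹) + S).mulVec r = v := by
    rw [hr, Matrix.mulVec_mulVec, Matrix.mul_nonsing_inv _ ((Matrix.isUnit_iff_isUnit_det _).1 hu),
      Matrix.one_mulVec]
  have h2 := congrFun h1 k
  rw [Matrix.add_mulVec, Pi.add_apply, Matrix.mulVec_diagonal] at h2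
  rw [← h2, div_eq_inv_mul]

-- By conjugacy the approximation is exact. The vector `r` carries the influence of the prior: with
-- `v = tiltDir`, the system gives `c ‖r‖² ≤ ⟨r, S r⟩ ≤ ⟨v, r⟩`, and Cauchy–Schwarz then bounds
-- `‖r‖` and `⟨v, r⟩`, the latter being the variance defect.
open scoped MatrixOrder in
theorem charFun_posteriorPsi_gaussianPrior (hκ : IsLabel n Ω κ) (hN : ∀ k, 0 < cellCount κ k)
    (f₀ a : ℝ → ℝ) {S : Matrix (Fin K) (Fin K) ℝ} (hS : S.PosDef) {c : ℝ} (hc0 : 0 < c)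
    (hc : ∀ k, c < hS.isHermitian.eigenvalues k) :
    ∃ (r : Fin K → ℝ) (τ : ℝ), 0 ≤ τ ∧ c ^ 2 * ∑ k, r k ^ 2 ≤ ∑ k, tiltDir κ a k ^ 2 ∧
      c * |∑ i, tiltDir κ a (κ i) ^ 2 - τ| ≤ ∑ k, tiltDir κ a k ^ 2 ∧
      ∀ Y : Fin n → ℝ, IsProbabilityMeasure (posteriorPsi n Ω f₀ a (gaussianPrior S) Y) ∧
        ∀ s : ℝ, ‖charFun (posteriorPsi n Ω f₀ a (gaussianPrior S) Y) s -
          Complex.exp (Complex.I * s * (-∑ k, r k * cellMean κ Y k : ℝ) - τ * s ^ 2 / 2)‖ ≤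
          0 * |s| := by
  set v := tiltDir κ a with hv
  obtain ⟨r, hr⟩ := exists_div_add_mulVec_eq hS hN v
  set ω := S.mulVec r with hω
  have hNr : ∀ k, cellCount κ k * (v k - ω k) = r k := fun k => by
    have := (hN k).ne'
    rw [← hr k]
    field_simp
    ring
  set M := CFC.sqrt S with hM
  have hMM : M * M = S := CFC.sqrt_mul_sqrt_self S hS.posSemidef.nonneg
  have hMsymm : M.transpose = M := by
    have h1 : IsSelfAdjoint M := (CFC.sqrt_nonneg S).isSelfAdjoint
    rw [← Matrix.conjTranspose_eq_transpose_of_trivial]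
    exact h1
  have hMdot : ∀ x y : Fin K → ℝ, x ⬝ᵥ M.mulVec y = M.mulVec x ⬝ᵥ y := fun x y => by
    rw [Matrix.dotProduct_mulVec, ← Matrix.mulVec_transpose, hMsymm]
  have hAw : M.mulVec (M.mulVec r) = ω := by rw [Matrix.mulVec_mulVec, hMM]
  have hrS : c * ∑ k, r k ^ 2 ≤ ∑ k, r k * ω k := mul_sum_sq_le_dotProduct_mulVec hS hc r
  have hr0 : 0 ≤ ∑ k, r k ^ 2 := Finset.sum_nonneg fun k _ => sq_nonneg _
  have hrω0 : 0 ≤ ∑ k, r k * ω k := le_trans (by positivity) hrS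
  set Q := ∑ k, v k * r k with hQ
  have hQr : c * ∑ k, r k ^ 2 ≤ Q := by
    refine hrS.trans (Finset.sum_le_sum fun k _ => ?_)
    have h1 : 0 ≤ r k * (r k / cellCount κ k) := by
      have := hN k
      rw [← mul_div_assoc]
      exact div_nonneg (mul_self_nonneg _) this.le
    have h2 : v k * r k = r k * (r k / cellCount κ k) + r k * ω k := by rw [← hr k]; ring
    linarith
  have hQ0 : 0 ≤ Q := le_trans (by positivity) hQr
  have hCS : Q ^ 2 ≤ (∑ k, v k ^ 2) * ∑ k, r k ^ 2 := Finset.sum_mul_sq_le_sq_mul_sq _ _ _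
  have hv0 : 0 ≤ ∑ k, v k ^ 2 := Finset.sum_nonneg fun k _ => sq_nonneg _
  have hQv : c * Q ≤ ∑ k, v k ^ 2 := by
    rcases hQ0.eq_or_lt with h | h
    · rw [← h, mul_zero]; exact hv0
    · nlinarith
  have hsumdiff : ∀ b : Fin K → ℝ, ∑ i, (v (κ i) - ω (κ i)) * b (κ i) = ∑ k, r k * b k := by
    intro b
    rw [sum_comp_label κ fun k => (v k - ω k) * b k]
    exact Finset.sum_congr rfl fun k _ => by rw [← mul_assoc, hNr]
  -- The excess of this sum over `∑ ω²` is `⟨r, S r⟩`, which is nonnegative.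
  have hτ0 : 0 ≤ ∑ i, v (κ i) * ω (κ i) := by
    have h1 := hsumdiff ω
    simp only [sub_mul, Finset.sum_sub_distrib] at h1
    have h2 : 0 ≤ ∑ i, ω (κ i) * ω (κ i) := Finset.sum_nonneg fun i _ => mul_self_nonneg _
    linarith
  refine ⟨r, ∑ i, v (κ i) * ω (κ i), hτ0, ?_, ?_, fun Y => ?_⟩
  · nlinarith
  · have h1 : ∑ i, v (κ i) ^ 2 - ∑ i, v (κ i) * ω (κ i) = Q := by
      rw [hQ, ← Finset.sum_congr rfl fun k _ => mul_comm (r k) (v k), ← hsumdiff v,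
        ← Finset.sum_sub_distrib]
      exact Finset.sum_congr rfl fun i _ => by ring
    rw [h1, abs_of_nonneg hQ0]
    exact hQv
  -- The latent shift `M r`, with `M = √S`, maps to `M M r = S r = ω`.
  · refine charFun_posteriorPsi_of_shift (w := M.mulVec r) hκ hN f₀ a Y M.mulVecLin
      (V := fun z => ∑ k, z k ^ 2 / 2) ?_ ?_ hτ0 ?_ ?_
    · simp_rw [← Finset.sum_neg_distrib]
      exact integrable_exp_sum integrable_exp_neg_sq_div_two
    · simp_rw [← Finset.sum_neg_distrib]
      exact gaussianPrior_eq_map S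
    · simp [hAw, hv]
    · intro h z
      simp only [Matrix.mulVecLin_apply, hAw, Pi.add_apply, Pi.smul_apply, smul_eq_mul,
        mul_zero, ← hv]
      have e1 : ∑ i, (v (κ i) - ω (κ i)) * (M.mulVec z (κ i) - Y i) =
          ∑ k, z k * M.mulVec r k - ∑ k, r k * cellMean κ Y k := by
        have e2 : ∑ i, (v (κ i) - ω (κ i)) * Y i = ∑ k, r k * cellMean κ Y k := by
          rw [← Finset.sum_congr rfl fun i _ => mul_comm (Y i) (v (κ i) - ω (κ i)),
            sum_mul_comp_label_eq_sum_cellMean hN Y fun k => v k - ω k]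
          exact Finset.sum_congr rfl fun k _ => by rw [← hNr k]; ring
        have e3 : ∑ k, z k * M.mulVec r k = ∑ k, r k * M.mulVec z k :=
          (hMdot z r).trans (dotProduct_comm _ _)
        simp only [mul_sub, Finset.sum_sub_distrib]
        rw [hsumdiff (M.mulVec z), e2, e3]
      have e4 : ∑ i, v (κ i) * ω (κ i) - ∑ i, ω (κ i) ^ 2 = ∑ k, M.mulVec r k ^ 2 := by
        have e5 : ∑ k, M.mulVec r k ^ 2 = ∑ k, r k * ω k := by
          have := hMdot r (M.mulVec r)
          rw [hAw] at this
          simp only [dotProduct] at this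
          rw [this]
          exact Finset.sum_congr rfl fun k _ => sq _
        rw [e5, ← hsumdiff ω, ← Finset.sum_sub_distrib]
        exact Finset.sum_congr rfl fun i _ => by ring
      rw [e1, e4, abs_nonpos_iff]
      have e6 : ∑ k, (z k + h * M.mulVec r k) ^ 2 / 2 - ∑ k, z k ^ 2 / 2 =
          h * ∑ k, z k * M.mulVec r k + h ^ 2 / 2 * ∑ k, M.mulVec r k ^ 2 := by
        rw [← Finset.sum_sub_distrib, Finset.mul_sum, Finset.mul_sum, ← Finset.sum_add_distrib]
        exact Finset.sum_congr rfl fun k _ => by ring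
      rw [e6]
      ring

end FixedSampleSize

/-! ### Linear forms in the noise -/

section Noise

instance (n : ℕ) (f₀ : ℝ → ℝ) : IsProbabilityMeasure (truth n f₀) := by
  unfold truth; infer_instance

/-- Chebyshev's inequality for linear combinations of the noise. -/
lemma truth_le_abs_sum_noise_le {n : ℕ} (f₀ : ℝ → ℝ) (b : Fin n → ℝ) {δ : ℝ} (hδ : 0 < δ) :
    truth n f₀ {Y | δ ≤ |∑ i, b i * (Y i - f₀ (design n i))|} ≤
      ENNReal.ofReal ((∑ i, b i ^ 2) / δ ^ 2) := by
  set X : Fin n → ℝ → ℝ := fun i y => b i * (y - f₀ (design n i)) with hX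
  have hmem : ∀ i, MemLp (X i) 2 (gaussianReal (f₀ (design n i)) 1) := fun i => by
    have h1 : MemLp id 2 (gaussianReal (f₀ (design n i)) 1) := IsGaussian.memLp_two_id
    exact (h1.sub (memLp_const _)).const_mul _
  have hmp : ∀ i, MeasurePreserving (Function.eval i) (truth n f₀)
      (gaussianReal (f₀ (design n i)) 1) := fun i => measurePreserving_eval _ i
  have hmem' : ∀ i, MemLp (fun Y : Fin n → ℝ => X i (Y i)) 2 (truth n f₀) := fun i =>
    (hmem i).comp_measurePreserving (hmp i)
  have hvar : Var[∑ i, fun Y : Fin n → ℝ => X i (Y i); truth n f₀] = ∑ i, b i ^ 2 := by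
    rw [truth, variance_sum_pi hmem]
    refine Finset.sum_congr rfl fun i _ => ?_
    simp only [hX]
    rw [variance_const_mul, variance_sub_const (by fun_prop)]
    have : Var[fun y => y; gaussianReal (f₀ (design n i)) 1] = 1 := by
      simp
    rw [this, mul_one]
  have hmean : ∫ Y, (∑ i, fun Y : Fin n → ℝ => X i (Y i)) Y ∂(truth n f₀) = 0 := by
    simp only [Finset.sum_apply]
    rw [integral_finsetSum _ fun i _ => (hmem' i).integrable (by norm_num)]
    refine Finset.sum_eq_zero fun i _ => ?_
    have h1 : ∫ Y, X i (Y i) ∂(truth n f₀) =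
        ∫ y, X i y ∂(gaussianReal (f₀ (design n i)) 1) := by
      rw [← (hmp i).map_eq, integral_map (hmp i).measurable.aemeasurable
        (by fun_prop : Measurable (X i)).aestronglyMeasurable]
    rw [h1]
    simp only [hX]
    rw [integral_const_mul, integral_sub (f := fun y => y) IsGaussian.integrable_id
      (integrable_const _)]
    simp
  have h := meas_ge_le_variance_div_sq (μ := truth n f₀)
    (memLp_finsetSum' Finset.univ fun i _ => hmem' i) hδ
  rw [hvar, hmean] at h
  simpa [hX] using h

/-- Only monotonicity of the measure is used, so the events, such as those given by `blDist`, need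
not be shown measurable. -/
lemma tendsto_truth_of_noise {f₀ : ℝ → ℝ} {e : ℕ → ℝ} (he : Tendsto e atTop (𝓝 0)) {δ : ℝ}
    (hδ : 0 < δ) {s : ∀ n, Set (Fin n → ℝ)}
    (h : ∀ᶠ n in atTop, ∃ b : Fin n → ℝ, ∑ i, b i ^ 2 ≤ e n ∧
      s n ⊆ {Y | δ ≤ |∑ i, b i * (Y i - f₀ (design n i))|}) :
    Tendsto (fun n => truth n f₀ (s n)) atTop (𝓝 0) := by
  have h0 : Tendsto (fun n => ENNReal.ofReal (e n / δ ^ 2)) atTop (𝓝 0) := by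
    have := ENNReal.tendsto_ofReal (he.div_const (δ ^ 2))
    simpa using this
  refine tendsto_of_tendsto_of_tendsto_of_le_of_le' tendsto_const_nhds h0
    (Eventually.of_forall fun _ => zero_le) ?_
  filter_upwards [h] with n ⟨b, hb, hs⟩
  refine (measure_mono hs).trans ((truth_le_abs_sum_noise_le f₀ b hδ).trans ?_)
  gcongr

lemma tendstoZeroInProb_of_noise {f₀ : ℝ → ℝ} {Z : ∀ n, (Fin n → ℝ) → ℝ} {d e : ℕ → ℝ}
    (hd : Tendsto d atTop (𝓝 0)) (he : Tendsto e atTop (𝓝 0))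
    (h : ∀ᶠ n in atTop, ∃ b : Fin n → ℝ, ∑ i, b i ^ 2 ≤ e n ∧
      ∀ Y, |Z n Y| ≤ d n + |∑ i, b i * (Y i - f₀ (design n i))|) :
    TendstoZeroInProb f₀ Z := by
  intro δ hδ
  refine tendsto_truth_of_noise he (half_pos hδ) ?_
  filter_upwards [h, hd.eventually_lt_const (half_pos hδ)] with n ⟨b, hb, hZ⟩ hdn
  refine ⟨b, hb, fun Y hY => ?_⟩
  have h1 := hZ Y
  simp only [Set.mem_ofPred_eq] at hY ⊢
  linarith

end Noise

/-! ### Reduction of asymptotic normality to characteristic functions -/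

section CharacteristicFunction

/-- Mean value inequality on the convex half-plane `Re ≤ 0`, where the derivative of `exp` has norm
at most one. -/
lemma norm_exp_sub_exp_le {z w : ℂ} (hz : z.re ≤ 0) (hw : w.re ≤ 0) :
    ‖Complex.exp z - Complex.exp w‖ ≤ ‖z - w‖ := by
  have h := (convex_halfSpace_re_le 0).norm_image_sub_le_of_norm_deriv_le (𝕜 := ℂ)
    (f := Complex.exp) (C := 1) (fun x _ => Complex.differentiableAt_exp) (fun x hx => ?_) hw hz
  · simpa using h
  · rw [Complex.deriv_exp, Complex.norm_exp]
    exact Real.exp_le_one_iff.2 hx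

lemma norm_gaussian_charFun_sub_le {τ v : ℝ} (hτ : 0 ≤ τ) (hv : 0 ≤ v) (m s : ℝ) :
    ‖Complex.exp (Complex.I * s * m - τ * s ^ 2 / 2) - Complex.exp (-(v * s ^ 2 / 2))‖ ≤
      |m| * |s| + |v - τ| * s ^ 2 := by
  have e1 : (Complex.I * s * m - τ * s ^ 2 / 2 : ℂ) =
      ((s * m : ℝ) : ℂ) * Complex.I + ((-(τ * s ^ 2 / 2) : ℝ) : ℂ) := by
    push_cast; ring
  have e2 : (-(v * s ^ 2 / 2) : ℂ) = ((-(v * s ^ 2 / 2) : ℝ) : ℂ) := by push_cast; ring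
  rw [e1, e2]
  refine (norm_exp_sub_exp_le ?_ ?_).trans ?_
  · simp only [Complex.add_re, Complex.re_ofReal_mul, Complex.I_re, Complex.ofReal_re]
    nlinarith [mul_nonneg hτ (sq_nonneg s)]
  · rw [Complex.ofReal_re]
    nlinarith [mul_nonneg hv (sq_nonneg s)]
  · rw [add_sub_assoc, ← Complex.ofReal_sub]
    refine (norm_add_le _ _).trans ?_
    rw [norm_mul, Complex.norm_I, mul_one, Complex.norm_real, Complex.norm_real,
      Real.norm_eq_abs, Real.norm_eq_abs, abs_mul, mul_comm |s|]
    have h : -(τ * s ^ 2 / 2) - -(v * s ^ 2 / 2) = (v - τ) * s ^ 2 * (1 / 2) := by ring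
    rw [h, abs_mul, abs_mul, abs_of_nonneg (sq_nonneg s), abs_of_pos (by norm_num : (0:ℝ) < 1 / 2)]
    nlinarith [mul_nonneg (abs_nonneg (v - τ)) (sq_nonneg s)]

lemma normSqL_nonneg (n : ℕ) (a : ℝ → ℝ) : 0 ≤ normSqL n a :=
  mul_nonneg (by positivity) (Finset.sum_nonneg fun _ _ => sq_nonneg _)

theorem posteriorAsympNormal_of_charFun {K : ℕ → ℕ} {Ω : ∀ n, Fin (K n) → Set ℝ} {f₀ a : ℝ → ℝ}
    {prior : ∀ n, Measure (Fin (K n) → ℝ)} {B : ℝ} (hB : ∀ n, normSqL n a ≤ B) {d e : ℕ → ℝ}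
    (hd : Tendsto d atTop (𝓝 0)) (he : Tendsto e atTop (𝓝 0))
    (h : ∀ᶠ n in atTop, ∃ (b : Fin n → ℝ) (τ : ℝ) (m : (Fin n → ℝ) → ℝ), 0 ≤ τ ∧
      |normSqL n a - τ| ≤ d n ∧ ∑ i, b i ^ 2 ≤ e n ∧
      ∀ Y, |m Y| ≤ d n + |∑ i, b i * (Y i - f₀ (design n i))| ∧
        IsProbabilityMeasure (posteriorPsi n (Ω n) f₀ a (prior n) Y) ∧
        ∀ s : ℝ, ‖charFun (posteriorPsi n (Ω n) f₀ a (prior n) Y) s -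
          Complex.exp (Complex.I * s * m Y - τ * s ^ 2 / 2)‖ ≤ d n * |s|) :
    PosteriorAsympNormal K Ω f₀ a prior := by
  intro δ hδ
  obtain ⟨η, hη, hbl⟩ := exists_forall_blDist_gaussianReal_le B (half_pos hδ)
  -- The budget `η` for the coefficient of `|s|` is split in three: deterministic bias, noise, and
  -- error of the characteristic function.
  refine tendsto_truth_of_noise he (div_pos hη three_pos) ?_
  filter_upwards [h, hd.eventually_lt_const (div_pos hη three_pos)] with n
    ⟨b, τ, m, hτ, hnorm, hb, hY⟩ hdn
  refine ⟨b, hb, fun Y hYδ => ?_⟩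
  obtain ⟨hm, hprob, hchar⟩ := hY Y
  simp only [Set.mem_ofPred_eq] at hYδ ⊢
  by_contra! hlt
  have hle : blDist (posteriorPsi n (Ω n) f₀ a (prior n) Y)
      (gaussianReal 0 (normSqL n a).toNNReal) ≤ δ / 2 := by
    have hcoe : ((normSqL n a).toNNReal : ℝ) = normSqL n a :=
      Real.coe_toNNReal _ (normSqL_nonneg n a)
    refine hbl _ _ (by rw [hcoe]; exact hB n) fun s => ?_
    have h1 := norm_gaussian_charFun_sub_le hτ (normSqL_nonneg n a) (m Y) s
    have h2 := norm_sub_le_norm_sub_add_norm_sub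
      (charFun (posteriorPsi n (Ω n) f₀ a (prior n) Y) s)
      (Complex.exp (Complex.I * s * m Y - τ * s ^ 2 / 2))
      (Complex.exp (-(((normSqL n a).toNNReal : ℝ) * s ^ 2 / 2)))
    rw [hcoe] at h2 ⊢
    have h3 := hchar s
    have h4 : d n * |s| ≤ η / 3 * |s| := by gcongr
    have h5 : |m Y| * |s| ≤ (2 * (η / 3)) * |s| := by
      gcongr
      linarith
    have h6 : |normSqL n a - τ| * s ^ 2 ≤ η * s ^ 2 := by
      gcongr
      linarith
    linarith
  rw [abs_of_nonneg (blDist_nonneg _ _)] at hYδ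
  linarith

end CharacteristicFunction

/-! ### Growth of the number of cells -/

section NumberOfCells

lemma tendsto_natCast_div_log : Tendsto (fun n : ℕ => (n : ℝ) / Real.log n) atTop atTop := by
  have h := Real.isLittleO_log_id_atTop.tendsto_div_nhds_zero
  have h1 : Tendsto (fun x : ℝ => Real.log x / x) atTop (𝓝[>] 0) := by
    refine tendsto_nhdsWithin_iff.2 ⟨h, ?_⟩
    filter_upwards [eventually_gt_atTop 1] with x hx
    exact div_pos (Real.log_pos hx) (by linarith)
  have h2 := h1.inv_tendsto_nhdsGT_zero.comp tendsto_natCast_atTop_atTop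
  refine h2.congr fun n => ?_
  simp

variable {α : ℝ}

lemma tendsto_Kn_base (hα : 0 < α) :
    Tendsto (fun n : ℕ => ((n : ℝ) / Real.log n) ^ (1 / (2 * α + 1))) atTop atTop :=
  (tendsto_rpow_atTop (by positivity)).comp tendsto_natCast_div_log

lemma tendsto_Kn (hα : 0 < α) : Tendsto (fun n => (Kn α n : ℝ)) atTop atTop :=
  tendsto_natCast_atTop_atTop.comp (tendsto_nat_floor_atTop.comp (tendsto_Kn_base hα))

lemma eventually_one_le_log : ∀ᶠ n : ℕ in atTop, 1 ≤ Real.log n :=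
  (Real.tendsto_log_atTop.comp tendsto_natCast_atTop_atTop).eventually_ge_atTop 1

/-- Once `log n ≥ 1`, `K_n ≤ n^{1/(2α+1)}`, and this exponent is below `1/2` exactly when `α > 1/2`.
-/
lemma tendsto_Kn_div_sqrt (hα : 1 / 2 < α) :
    Tendsto (fun n : ℕ => (Kn α n : ℝ) / Real.sqrt n) atTop (𝓝 0) := by
  have hp : 0 < 1 / 2 - 1 / (2 * α + 1) := by
    rw [sub_pos, div_lt_div_iff₀ (by linarith) two_pos]
    linarith
  have h0 : Tendsto (fun n : ℕ => ((n : ℝ) ^ (-(1 / 2 - 1 / (2 * α + 1))))) atTop (𝓝 0) :=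
    (tendsto_rpow_neg_atTop hp).comp tendsto_natCast_atTop_atTop
  refine squeeze_zero' (Eventually.of_forall fun n => by positivity) ?_ h0
  filter_upwards [eventually_one_le_log, eventually_gt_atTop 0] with n hlog hn
  have hn' : (0 : ℝ) < n := by exact_mod_cast hn
  rw [neg_sub, Real.rpow_sub hn', Real.sqrt_eq_rpow]
  gcongr
  refine (Nat.floor_le (by positivity)).trans ?_
  have : (n : ℝ) / Real.log n ≤ n := div_le_self hn'.le hlog
  have : 0 ≤ 1 / (2 * α + 1) := by
    have : 0 < 2 * α + 1 := by linarith
    positivity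
  gcongr

/-- Up to a constant, `K_n^{-ρ}` is at most `(log n / n)^{ρ/(2α+1)}`. The exponent exceeds `1/2`,
and the remaining power of `n` beats the logarithm. -/
lemma tendsto_sqrt_mul_Kn_rpow {ρ : ℝ} (hα : 0 < α) (hρ : α + 1 / 2 < ρ) :
    Tendsto (fun n : ℕ => Real.sqrt n * ((Kn α n : ℝ)⁻¹) ^ ρ) atTop (𝓝 0) := by
  set p := 1 / (2 * α + 1) with hp
  have hp0 : 0 < p := by positivity
  have hρ0 : 0 < ρ := by linarith
  have hq : 0 < p * ρ - 1 / 2 := by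
    rw [hp, sub_pos, one_div_mul_eq_div, div_lt_div_iff₀ two_pos (by positivity)]
    linarith
  have h0 : Tendsto (fun n : ℕ => (2 : ℝ) ^ ρ *
      (Real.log n ^ (p * ρ) / (n : ℝ) ^ (p * ρ - 1 / 2))) atTop (𝓝 0) := by
    have h1 := (isLittleO_log_rpow_rpow_atTop (p * ρ) hq).tendsto_div_nhds_zero.comp
      tendsto_natCast_atTop_atTop
    simpa using h1.const_mul ((2 : ℝ) ^ ρ)
  refine squeeze_zero' (Eventually.of_forall fun n => by positivity) ?_ h0
  filter_upwards [eventually_one_le_log, eventually_gt_atTop 0,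
    (tendsto_Kn_base hα).eventually_ge_atTop 2] with n hlog hn hbase
  have hn' : (0 : ℝ) < n := by exact_mod_cast hn
  have hlog0 : 0 < Real.log n := by linarith
  have hu : 0 < (n : ℝ) / Real.log n := div_pos hn' hlog0
  -- Taking the floor of a number at least 2 loses at most a factor 2.
  have hK : ((n : ℝ) / Real.log n) ^ p / 2 ≤ Kn α n := by
    have := Nat.lt_floor_add_one (((n : ℝ) / Real.log n) ^ p)
    rw [Kn]
    linarith
  have h1 : ((Kn α n : ℝ)⁻¹) ^ ρ ≤ (2 : ℝ) ^ ρ * ((n : ℝ) / Real.log n) ^ (-(p * ρ)) := by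
    have h2 : ((Kn α n : ℝ)⁻¹) ≤ 2 * ((n : ℝ) / Real.log n) ^ (-p) := by
      rw [Real.rpow_neg hu.le]
      calc ((Kn α n : ℝ)⁻¹) ≤ (((n : ℝ) / Real.log n) ^ p / 2)⁻¹ := by gcongr
        _ = _ := by rw [inv_div, div_eq_mul_inv]
    calc ((Kn α n : ℝ)⁻¹) ^ ρ ≤ (2 * ((n : ℝ) / Real.log n) ^ (-p)) ^ ρ := by gcongr
      _ = _ := by rw [Real.mul_rpow two_pos.le (by positivity), ← Real.rpow_mul hu.le, neg_mul]
  calc Real.sqrt n * ((Kn α n : ℝ)⁻¹) ^ ρ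
      ≤ Real.sqrt n * ((2 : ℝ) ^ ρ * ((n : ℝ) / Real.log n) ^ (-(p * ρ))) := by gcongr
    _ = _ := by
      rw [Real.rpow_neg hu.le, Real.div_rpow hn'.le hlog0.le, Real.rpow_sub hn',
        Real.sqrt_eq_rpow]
      have := Real.rpow_pos_of_pos hn' (p * ρ)
      have := Real.rpow_pos_of_pos hn' (1 / 2)
      field_simp

end NumberOfCells

/-! ### Oscillation within cells -/

section CellOscillation

variable {n K : ℕ} {Ω : Fin K → Set ℝ} {κ : Fin n → Fin K}

/-- A cell is an interval, so it contains all `j - i + 1` design points from `i` to `j`. Mass thus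
controls the spread of design points, without any bound on the length of the cell. -/
lemma IsLabel.design_sub_le (hκ : IsLabel n Ω κ) (hΩ : IsIntervalPartition Ω) {i j : Fin n}
    (hij : i ≤ j) (hk : κ j = κ i) :
    |design n j - design n i| ≤ cellMass n (Ω (κ i)) := by
  have hn' : (0 : ℝ) < n := by exact_mod_cast i.pos
  have hij' : (i : ℕ) ≤ j := hij
  have hsub : Finset.Icc i j ⊆ Finset.univ.filter fun l => κ l = κ i := by
    intro l hl
    rw [Finset.mem_Icc] at hl
    rw [Finset.mem_filter]
    refine ⟨Finset.mem_univ _, (hκ l _).1 ?_⟩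
    refine (hΩ.interval (κ i)).out ((hκ i _).2 rfl) ((hκ j _).2 hk) ⟨?_, ?_⟩
    all_goals
      simp only [design]
      gcongr
    · exact hl.1
    · exact hl.2
  have hcard := Finset.card_le_card hsub
  rw [Fin.card_Icc] at hcard
  rw [hκ.cellMass_eq, cellCount, design, design, ← sub_div, abs_div, abs_of_pos hn']
  gcongr
  have h1 : ((i : ℕ) : ℝ) ≤ (j : ℕ) := by exact_mod_cast hij'
  have h2 : ((j : ℕ) : ℝ) ≤ ((Finset.univ.filter fun l => κ l = κ i).card : ℝ) + (i : ℕ) := by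
    exact_mod_cast (by omega : (j : ℕ) ≤ (Finset.univ.filter fun l => κ l = κ i).card + (i : ℕ))
  rw [abs_of_nonneg (by linarith)]
  linarith

lemma IsLabel.abs_design_sub_le (hκ : IsLabel n Ω κ) (hΩ : IsIntervalPartition Ω) {i j : Fin n}
    (hk : κ j = κ i) : |design n i - design n j| ≤ cellMass n (Ω (κ i)) := by
  rcases le_total i j with h | h
  · rw [abs_sub_comm]
    exact hκ.design_sub_le hΩ h hk
  · have := hκ.design_sub_le hΩ h hk.symm
    rwa [hk] at this

lemma abs_sub_cellMean_le (hN : ∀ k, 0 < cellCount κ k) {y : Fin n → ℝ} {i : Fin n} {D : ℝ}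
    (h : ∀ j, κ j = κ i → |y i - y j| ≤ D) : |y i - cellMean κ y (κ i)| ≤ D := by
  have hN' := hN (κ i)
  have h1 : y i - cellMean κ y (κ i) =
      (∑ j with κ j = κ i, (y i - y j)) / cellCount κ (κ i) := by
    rw [Finset.sum_sub_distrib, Finset.sum_const, nsmul_eq_mul, sub_div, cellMean]
    congr 1
    exact (mul_div_cancel_left₀ _ hN'.ne').symm
  rw [h1, abs_div, abs_of_pos hN', div_le_iff₀ hN']
  refine (Finset.abs_sum_le_sum_abs _ _).trans ?_
  refine (Finset.sum_le_card_nsmul _ _ D fun j hj => h j (Finset.mem_filter.1 hj).2).trans ?_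
  rw [nsmul_eq_mul, mul_comm]
  rfl

lemma abs_cellMean_le (hN : ∀ k, 0 < cellCount κ k) {y : Fin n → ℝ} {F : ℝ}
    (h : ∀ i, |y i| ≤ F) (k : Fin K) : |cellMean κ y k| ≤ F := by
  have hN' := hN k
  rw [cellMean, abs_div, abs_of_pos hN', div_le_iff₀ hN']
  refine (Finset.abs_sum_le_sum_abs _ _).trans ?_
  refine (Finset.sum_le_card_nsmul _ _ F fun j _ => h j).trans ?_
  rw [nsmul_eq_mul, mul_comm]
  rfl

lemma abs_sub_le_of_holderOnWith {C r : ℝ≥0} {g : ℝ → ℝ} (hg : HolderOnWith C r g (Set.Icc 0 1))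
    {x y t : ℝ} (hx : x ∈ Set.Icc (0 : ℝ) 1) (hy : y ∈ Set.Icc (0 : ℝ) 1) (ht : |x - y| ≤ t) :
    |g x - g y| ≤ C * t ^ (r : ℝ) := by
  have ht' : dist x y ≤ t := by rwa [Real.dist_eq]
  simpa [Real.dist_eq] using hg.dist_le_of_le hx hy ht'

lemma exists_abs_design_le_of_holderOnWith {C r : ℝ≥0} {g : ℝ → ℝ}
    (hg : HolderOnWith C r g (Set.Icc 0 1)) :
    ∃ A : ℝ, 0 ≤ A ∧ ∀ (n : ℕ) (i : Fin n), |g (design n i)| ≤ A := by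
  refine ⟨|g 0| + C, by positivity, fun n i => ?_⟩
  have hx := design_mem_Icc i
  have h := abs_sub_le_of_holderOnWith hg hx (y := 0) (t := 1) (by simp)
    (by rw [sub_zero, abs_of_nonneg hx.1]; exact hx.2)
  rw [Real.one_rpow, mul_one] at h
  have := abs_sub_abs_le_abs_sub (g (design n i)) (g 0)
  linarith

end CellOscillation

/-! ### Asymptotics and assembly -/

section Asymptotics

variable {n K : ℕ} {Ω : Fin K → Set ℝ} {κ : Fin n → Fin K}

lemma sum_tiltDir_sq_le (hN : ∀ k, 0 < cellCount κ k) {a : ℝ → ℝ} {A : ℝ}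
    (hA : ∀ i : Fin n, |a (design n i)| ≤ A) :
    ∑ k, tiltDir κ a k ^ 2 ≤ A ^ 2 * (K / n) := by
  calc ∑ k, tiltDir κ a k ^ 2 ≤ ∑ _k : Fin K, A ^ 2 / n := by
        refine Finset.sum_le_sum fun k _ => ?_
        rw [tiltDir, div_pow, Real.sq_sqrt (Nat.cast_nonneg n)]
        have := abs_cellMean_le hN hA k
        gcongr 1
        exact sq_le_sq' (abs_le.1 this).1 (abs_le.1 this).2
    _ = A ^ 2 * (K / n) := by simp; ring

lemma sum_abs_tiltDir_le (hN : ∀ k, 0 < cellCount κ k) {a : ℝ → ℝ} {A : ℝ}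
    (hA : ∀ i : Fin n, |a (design n i)| ≤ A) :
    ∑ k, |tiltDir κ a k| ≤ A * (K / Real.sqrt n) := by
  calc ∑ k, |tiltDir κ a k| ≤ ∑ _k : Fin K, A / Real.sqrt n := by
        refine Finset.sum_le_sum fun k _ => ?_
        rw [tiltDir, abs_div, abs_of_nonneg (Real.sqrt_nonneg _)]
        have := abs_cellMean_le hN hA k
        gcongr
    _ = A * (K / Real.sqrt n) := by simp; ring

lemma mean_sq_le {y : Fin n → ℝ} {D : ℝ} (h : ∀ i, |y i| ≤ D) :
    1 / (n : ℝ) * ∑ i, y i ^ 2 ≤ D ^ 2 := by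
  rcases Nat.eq_zero_or_pos n with rfl | hn
  · simpa using sq_nonneg D
  have hn' : (0 : ℝ) < n := by exact_mod_cast hn
  have h1 : ∑ i, y i ^ 2 ≤ ∑ _i : Fin n, D ^ 2 :=
    Finset.sum_le_sum fun i _ => sq_le_sq' (abs_le.1 (h i)).1 (abs_le.1 (h i)).2
  rw [one_div, inv_mul_le_iff₀ hn']
  simpa using h1

lemma abs_normSqL_sub_sum_tiltDir_sq_le (hN : ∀ k, 0 < cellCount κ k) {a : ℝ → ℝ} {D : ℝ}
    (hD : ∀ i, |a (design n i) - cellMean κ (fun i => a (design n i)) (κ i)| ≤ D) :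
    |normSqL n a - ∑ i, tiltDir κ a (κ i) ^ 2| ≤ D ^ 2 := by
  have h1 := normSqL_sub_sum_cellMean_sq hN a
  have h2 := mean_sq_le hD
  simp only [tiltDir]
  rw [h1, abs_of_nonneg (mul_nonneg (by positivity) (Finset.sum_nonneg fun _ _ => sq_nonneg _))]
  exact h2

/-- The lower mass bound forces a design point into every cell; the upper one bounds the spread, and
hence Hölder oscillations, at scale `1 / K_n`. -/
lemma EquivalentBlocks.eventually_isLabel {K : ℕ → ℕ} {Ω : ∀ n, Fin (K n) → Set ℝ}
    (hΩ : EquivalentBlocks K Ω) (hK : Tendsto (fun n => (K n : ℝ)) atTop atTop) :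
    ∃ C : ℝ, 0 ≤ C ∧ ∀ᶠ n in atTop, ∃ κ : Fin n → Fin (K n), IsLabel n (Ω n) κ ∧
      (∀ k, 1 ≤ cellCount κ k) ∧ ∀ (C' r : ℝ≥0) (g : ℝ → ℝ),
        HolderOnWith C' r g (Set.Icc 0 1) → ∀ i,
          |g (design n i) - cellMean κ (fun i => g (design n i)) (κ i)| ≤
            C' * (C * (K n : ℝ)⁻¹) ^ (r : ℝ) := by
  obtain ⟨c, C, hc, hC, h⟩ := hΩ
  refine ⟨C, hC.le, ?_⟩
  filter_upwards [h, hK.eventually_gt_atTop 0, eventually_gt_atTop 0] with n ⟨hpart, hmass⟩ hKn hn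
  obtain ⟨κ, hκ⟩ := hpart.exists_isLabel n
  have hn' : (0 : ℝ) < n := by exact_mod_cast hn
  have hN : ∀ k, 0 < cellCount κ k := fun k => by
    have h1 : 0 < cellMass n (Ω n k) := (div_pos hc hKn).trans_le (hmass k).1
    rw [hκ.cellMass_eq] at h1
    exact (div_pos_iff_of_pos_right hn').1 h1
  refine ⟨κ, hκ, fun k => ?_, fun C' r g hg i => ?_⟩
  · have := hN k
    rw [cellCount] at this ⊢
    exact_mod_cast this
  · refine abs_sub_cellMean_le hN (y := fun i => g (design n i)) fun j hj =>
      abs_sub_le_of_holderOnWith hg (design_mem_Icc i) (design_mem_Icc j) ?_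
    exact (hκ.abs_design_sub_le hpart hj).trans ((hmass _).2.trans_eq (div_eq_mul_inv _ _))

lemma tendsto_mul_inv_rpow {x : ℕ → ℝ} (hx : Tendsto x atTop atTop) {C r : ℝ} (hr : 0 < r) :
    Tendsto (fun n => (C * (x n)⁻¹) ^ r) atTop (𝓝 0) := by
  have h1 : Tendsto (fun n => C * (x n)⁻¹) atTop (𝓝 0) := by
    simpa using (tendsto_inv_atTop_zero.comp hx).const_mul C
  have h2 := h1.rpow_const (p := r) (Or.inr hr.le)
  rwa [Real.zero_rpow hr.ne'] at h2

lemma div_natCast_le_div_sqrt {x : ℝ} (hx : 0 ≤ x) (n : ℕ) : x / n ≤ x / Real.sqrt n := by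
  rcases Nat.eq_zero_or_pos n with rfl | hn
  · simp
  have hn' : (1 : ℝ) ≤ n := by exact_mod_cast hn
  have h1 : 0 < Real.sqrt n := Real.sqrt_pos.2 (by linarith)
  gcongr
  rw [Real.sqrt_le_left (by linarith)]
  nlinarith

lemma tendsto_Kn_div {α : ℝ} (hα : 1 / 2 < α) :
    Tendsto (fun n : ℕ => (Kn α n : ℝ) / n) atTop (𝓝 0) :=
  squeeze_zero (fun n => by positivity)
    (fun n => div_natCast_le_div_sqrt (Nat.cast_nonneg _) n) (tendsto_Kn_div_sqrt hα)

variable {α γ : ℝ≥0} {f₀ a : ℝ → ℝ} {Ω : ∀ n : ℕ, Fin (Kn α n) → Set ℝ}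

theorem posteriorAsympNormal_laplacePrior (hα : (1 / 2 : ℝ) < α) (hγ : 0 < γ)
    (ha : ∃ C : ℝ≥0, HolderOnWith C γ a (Set.Icc 0 1)) (hΩ : EquivalentBlocks (Kn α) Ω)
    {l : ℝ} (hl : 0 < l) :
    PosteriorAsympNormal (Kn α) Ω f₀ a fun n => laplacePrior l (Kn α n) := by
  obtain ⟨Ca, ha⟩ := ha
  obtain ⟨A, hA0, hA⟩ := exists_abs_design_le_of_holderOnWith ha
  have hK := tendsto_Kn (α := α) (by linarith)
  obtain ⟨C, hC, hev⟩ := hΩ.eventually_isLabel hK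
  have hγ' : (0 : ℝ) < γ := by exact_mod_cast hγ
  have hd : Tendsto (fun n : ℕ => (Ca * (C * (Kn α n : ℝ)⁻¹) ^ (γ : ℝ)) ^ 2 +
      l * (A * (Kn α n / Real.sqrt n))) atTop (𝓝 0) := by
    simpa using (((tendsto_mul_inv_rpow hK hγ').const_mul _).pow 2).add
      (((tendsto_Kn_div_sqrt hα).const_mul A).const_mul l)
  refine posteriorAsympNormal_of_charFun (fun n => mean_sq_le (hA n)) hd tendsto_const_nhds ?_
  filter_upwards [hev] with n ⟨κ, hκ, hN1, hosc⟩
  have hN : ∀ k, 0 < cellCount κ k := fun k => one_pos.trans_le (hN1 k)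
  have h1 := abs_normSqL_sub_sum_tiltDir_sq_le hN (hosc Ca γ a ha)
  have h2 := sum_abs_tiltDir_le hN (hA n)
  have h3 : 0 ≤ A * ((Kn α n : ℝ) / Real.sqrt n) := by positivity
  -- The approximating mean is zero, so no noise term is needed.
  refine ⟨0, ∑ i, tiltDir κ a (κ i) ^ 2, fun _ => 0, Finset.sum_nonneg fun _ _ => sq_nonneg _,
    ?_, by simp, fun Y => ⟨?_, ?_⟩⟩
  · have := mul_nonneg hl.le h3
    linarith
  · simp only [abs_zero]
    positivity
  · obtain ⟨hp, hc⟩ := charFun_posteriorPsi_laplacePrior hκ hN f₀ a hl Y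
    refine ⟨hp, fun s => (hc s).trans ?_⟩
    gcongr
    have h4 : l * ∑ k, |tiltDir κ a k| ≤ l * (A * (Kn α n / Real.sqrt n)) := by gcongr
    have := sq_nonneg (Ca * (C * (Kn α n : ℝ)⁻¹) ^ (γ : ℝ))
    linarith

theorem posteriorAsympNormal_gaussianPrior (hα : (1 / 2 : ℝ) < α) (hγ : 0 < γ)
    (hf₀ : ∃ C : ℝ≥0, HolderOnWith C α f₀ (Set.Icc 0 1))
    (ha : ∃ C : ℝ≥0, HolderOnWith C γ a (Set.Icc 0 1)) (hΩ : EquivalentBlocks (Kn α) Ω)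
    {S : ∀ n : ℕ, Matrix (Fin (Kn α n)) (Fin (Kn α n)) ℝ} (hS : AdmissibleCov (Kn α) S) :
    PosteriorAsympNormal (Kn α) Ω f₀ a fun n => gaussianPrior (S n) := by
  obtain ⟨Ca, ha⟩ := ha
  obtain ⟨Cf, hf₀⟩ := hf₀
  obtain ⟨A, hA0, hA⟩ := exists_abs_design_le_of_holderOnWith ha
  obtain ⟨F, hF0, hF⟩ := exists_abs_design_le_of_holderOnWith hf₀
  obtain ⟨c, _, hc0, hS⟩ := hS
  have hK := tendsto_Kn (α := α) (by linarith)
  obtain ⟨C, hC, hev⟩ := hΩ.eventually_isLabel hK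
  have hγ' : (0 : ℝ) < γ := by exact_mod_cast hγ
  have hd : Tendsto (fun n : ℕ => (Ca * (C * (Kn α n : ℝ)⁻¹) ^ (γ : ℝ)) ^ 2 +
      A ^ 2 * (Kn α n / n) / c + F * (A / c) * (Kn α n / Real.sqrt n)) atTop (𝓝 0) := by
    simpa using ((((tendsto_mul_inv_rpow hK hγ').const_mul _).pow 2).add
      (((tendsto_Kn_div hα).const_mul (A ^ 2)).div_const c)).add
      ((tendsto_Kn_div_sqrt hα).const_mul (F * (A / c)))
  have he : Tendsto (fun n : ℕ => A ^ 2 * ((Kn α n : ℝ) / n) / c ^ 2) atTop (𝓝 0) := by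
    simpa using ((tendsto_Kn_div hα).const_mul (A ^ 2)).div_const (c ^ 2)
  refine posteriorAsympNormal_of_charFun (fun n => mean_sq_le (hA n)) hd he ?_
  filter_upwards [hev, hS] with n ⟨κ, hκ, hN1, hosc⟩ ⟨hpd, heig⟩
  have hN : ∀ k, 0 < cellCount κ k := fun k => one_pos.trans_le (hN1 k)
  have h1 := abs_normSqL_sub_sum_tiltDir_sq_le hN (hosc Ca γ a ha)
  have h2 := sum_tiltDir_sq_le hN (hA n)
  obtain ⟨r, τ, hτ0, hr, hτ, hY⟩ :=
    charFun_posteriorPsi_gaussianPrior hκ hN f₀ a hpd hc0 fun k => (heig k).1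
  have hr2 : ∑ k, r k ^ 2 ≤ A ^ 2 * ((Kn α n : ℝ) / n) / c ^ 2 := by
    rw [le_div_iff₀ (by positivity)]
    linarith
  have hnn1 : 0 ≤ (Ca * (C * (Kn α n : ℝ)⁻¹) ^ (γ : ℝ)) ^ 2 := sq_nonneg _
  have hnn2 : 0 ≤ A ^ 2 * ((Kn α n : ℝ) / n) / c := by positivity
  have hnn3 : 0 ≤ F * (A / c) * ((Kn α n : ℝ) / Real.sqrt n) := by positivity
  -- Cauchy–Schwarz costs `√K` on top of `‖r‖ ≤ (A / c) √(K / n)`; this is where the prior bias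
  -- reaches order `K / √n`.
  have hrabs : ∑ k, |r k| ≤ A / c * (Kn α n / Real.sqrt n) := by
    refine abs_le_of_sq_le_sq' ?_ (by positivity) |>.2
    have h3 := sq_sum_le_card_mul_sum_sq (s := Finset.univ) (f := fun k => |r k|)
    simp only [sq_abs, Finset.card_univ, Fintype.card_fin] at h3
    calc _ ≤ (Kn α n : ℝ) * ∑ k, r k ^ 2 := h3
      _ ≤ Kn α n * (A ^ 2 * ((Kn α n : ℝ) / n) / c ^ 2) := by gcongr
      _ = _ := by
        rw [mul_pow, div_pow, div_pow, Real.sq_sqrt (Nat.cast_nonneg n)]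
        ring
  -- These weights are the coefficients of the noise in the mean `-∑ r_k Ȳ_k`. Their sum of squares
  -- is `∑ r_k² / N_k`, at most `‖r‖²` because every cell has a point.
  refine ⟨fun i => -(r (κ i) / cellCount κ (κ i)), τ,
    fun Y => -∑ k, r k * cellMean κ Y k, hτ0, ?_, ?_, fun Y => ⟨?_, (hY Y).1, fun s => ?_⟩⟩
  · have h3 : |∑ i, tiltDir κ a (κ i) ^ 2 - τ| ≤ A ^ 2 * ((Kn α n : ℝ) / n) / c := by
      rw [le_div_iff₀ hc0]
      linarith
    have := abs_sub_le (normSqL n a) (∑ i, tiltDir κ a (κ i) ^ 2) τ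
    linarith
  · refine le_trans ?_ hr2
    simp only [neg_sq]
    rw [sum_comp_label κ fun k => (r k / cellCount κ k) ^ 2]
    refine Finset.sum_le_sum fun k _ => ?_
    have h3 : cellCount κ k * (r k / cellCount κ k) ^ 2 = r k ^ 2 / cellCount κ k := by
      have := (hN k).ne'
      field_simp
    rw [h3]
    exact div_le_self (sq_nonneg _) (hN1 k)
  · have h3 : -∑ k, r k * cellMean κ Y k =
        -∑ k, r k * cellMean κ (fun i => f₀ (design n i)) k +
          ∑ i, -(r (κ i) / cellCount κ (κ i)) * (Y i - f₀ (design n i)) := by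
      have h4 : ∀ y : Fin n → ℝ, ∑ k, r k * cellMean κ y k =
          ∑ i, r (κ i) / cellCount κ (κ i) * y i := fun y => by
        rw [← Finset.sum_congr rfl fun i _ => mul_comm (y i) (r (κ i) / cellCount κ (κ i)),
          sum_mul_comp_label_eq_sum_cellMean hN y fun k => r k / cellCount κ k]
        refine Finset.sum_congr rfl fun k _ => ?_
        have := (hN k).ne'
        field_simp
      rw [h4, h4, ← Finset.sum_neg_distrib, ← Finset.sum_neg_distrib, ← Finset.sum_add_distrib]
      exact Finset.sum_congr rfl fun i _ => by ring
    beta_reduce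
    rw [h3]
    refine (abs_add_le _ _).trans ?_
    gcongr
    rw [abs_neg]
    have h5 : |∑ k, r k * cellMean κ (fun i => f₀ (design n i)) k| ≤ F * ∑ k, |r k| := by
      rw [Finset.mul_sum]
      refine (Finset.abs_sum_le_sum_abs _ _).trans (Finset.sum_le_sum fun k _ => ?_)
      rw [abs_mul, mul_comm]
      have := abs_cellMean_le hN (hF n) k
      gcongr
    have h6 : F * ∑ k, |r k| ≤ F * (A / c * (Kn α n / Real.sqrt n)) := by gcongr
    linarith
  · refine ((hY Y).2 s).trans ?_
    gcongr
    linarith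

theorem tendstoZeroInProb_psiHat_sub_psiN (hα : (1 / 2 : ℝ) < α) (hγ : (1 / 2 : ℝ) < γ)
    (hf₀ : ∃ C : ℝ≥0, HolderOnWith C α f₀ (Set.Icc 0 1))
    (ha : ∃ C : ℝ≥0, HolderOnWith C γ a (Set.Icc 0 1)) (hΩ : EquivalentBlocks (Kn α) Ω) :
    TendstoZeroInProb f₀ fun n Y =>
      Real.sqrt n * (psiHat n (Ω n) f₀ a Y - psiN n f₀ a Y) := by
  obtain ⟨Ca, ha⟩ := ha
  obtain ⟨Cf, hf₀⟩ := hf₀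
  have hK := tendsto_Kn (α := α) (by linarith)
  obtain ⟨C, hC, hev⟩ := hΩ.eventually_isLabel hK
  have hd : Tendsto (fun n : ℕ => Ca * Cf * C ^ ((γ : ℝ) + α) *
      (Real.sqrt n * ((Kn α n : ℝ)⁻¹) ^ ((γ : ℝ) + α))) atTop (𝓝 0) := by
    simpa using (tendsto_sqrt_mul_Kn_rpow (α := α) (ρ := γ + α) (by linarith)
      (by linarith)).const_mul (Ca * Cf * C ^ ((γ : ℝ) + α))
  have he : Tendsto (fun n : ℕ => (Ca * (C * (Kn α n : ℝ)⁻¹) ^ (γ : ℝ)) ^ 2) atTop (𝓝 0) := by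
    simpa using ((tendsto_mul_inv_rpow hK (by linarith : (0 : ℝ) < γ)).const_mul (Ca : ℝ)).pow 2
  refine tendstoZeroInProb_of_noise hd he ?_
  filter_upwards [hev] with n ⟨κ, hκ, hN1, hosc⟩
  have hN : ∀ k, 0 < cellCount κ k := fun k => one_pos.trans_le (hN1 k)
  have hDa := hosc Ca γ a ha
  have hDf := hosc Cf α f₀ hf₀
  refine ⟨fun i => (cellMean κ (fun i => a (design n i)) (κ i) - a (design n i)) / Real.sqrt n,
    ?_, fun Y => ?_⟩
  · refine le_of_eq_of_le ?_ (mean_sq_le hDa)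
    rw [Finset.mul_sum]
    refine Finset.sum_congr rfl fun i _ => ?_
    rw [div_pow, Real.sq_sqrt (Nat.cast_nonneg n)]
    ring
  · rw [hκ.sqrt_mul_psiHat_sub_psiN hN]
    refine (abs_add_le _ _).trans ?_
    gcongr
    set Da := Ca * (C * (Kn α n : ℝ)⁻¹) ^ (γ : ℝ) with hDa'
    set Df := Cf * (C * (Kn α n : ℝ)⁻¹) ^ (α : ℝ) with hDf'
    have h1 : |∑ i, (a (design n i) - cellMean κ (fun i => a (design n i)) (κ i)) *
        (cellMean κ (fun i => f₀ (design n i)) (κ i) - f₀ (design n i))| ≤ n * (Da * Df) := by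
      refine (Finset.abs_sum_le_sum_abs _ _).trans ?_
      refine (Finset.sum_le_card_nsmul _ _ (Da * Df) fun i _ => ?_).trans (by simp)
      rw [abs_mul]
      refine mul_le_mul (hDa i) ?_ (abs_nonneg _) ((abs_nonneg _).trans (hDa i))
      rw [abs_sub_comm]
      exact hDf i
    rw [abs_mul, abs_of_nonneg (by positivity : 0 ≤ 1 / Real.sqrt n)]
    calc _ ≤ 1 / Real.sqrt n * (n * (Da * Df)) := by gcongr
      _ = Real.sqrt n * (Da * Df) := by
        rw [← mul_assoc, one_div_mul_eq_div, Real.div_sqrt]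
      _ = _ := by
        rw [hDa', hDf', Real.mul_rpow hC (by positivity), Real.mul_rpow hC (by positivity),
          Real.rpow_add_of_nonneg hC (by positivity) (by positivity),
          Real.rpow_add_of_nonneg (by positivity) (by positivity) (by positivity)]
        ring

end Asymptotics

end HistogramBvM

end

theorem theorem1 (α γ : ℝ≥0) (hα : 1 / 2 < α) (hα' : α ≤ 1) (hγ : 1 / 2 < γ)
    (f₀ a : ℝ → ℝ)
    (hf₀ : ∃ C : ℝ≥0, HolderOnWith C α f₀ (Set.Icc 0 1))
    (ha : ∃ C : ℝ≥0, HolderOnWith C γ a (Set.Icc 0 1))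
    (Ω : ∀ n : ℕ, Fin (HistogramBvM.Kn α n) → Set ℝ)
    (hΩ : HistogramBvM.EquivalentBlocks (HistogramBvM.Kn α) Ω) :
    (∀ S : ∀ n : ℕ, Matrix (Fin (HistogramBvM.Kn α n)) (Fin (HistogramBvM.Kn α n)) ℝ,
      HistogramBvM.AdmissibleCov (HistogramBvM.Kn α) S →
        HistogramBvM.PosteriorAsympNormal (HistogramBvM.Kn α) Ω f₀ a
          fun n => HistogramBvM.gaussianPrior (S n)) ∧
    (∀ l : ℝ, 0 < l →
      HistogramBvM.PosteriorAsympNormal (HistogramBvM.Kn α) Ω f₀ a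
        fun n => HistogramBvM.laplacePrior l (HistogramBvM.Kn α n)) ∧
    HistogramBvM.TendstoZeroInProb f₀ (fun n Y =>
      Real.sqrt n * (HistogramBvM.psiHat n (Ω n) f₀ a Y - HistogramBvM.psiN n f₀ a Y)) := by
  have hα1 : (1 / 2 : ℝ) < α := by exact_mod_cast hα
  have hγ1 : (1 / 2 : ℝ) < γ := by exact_mod_cast hγ
  have hγ0 : 0 < γ := lt_trans (by norm_num) hγ
  exact ⟨fun S hS => HistogramBvM.posteriorAsympNormal_gaussianPrior hα1 hγ0 hf₀ ha hΩ hS,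
    fun l hl => HistogramBvM.posteriorAsympNormal_laplacePrior hα1 hγ0 ha hΩ hl,
    HistogramBvM.tendstoZeroInProb_psiHat_sub_psiN hα1 hγ1 hf₀ ha hΩ⟩
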